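/- Let $k$ be an algebraically closed field of characteristic $p>0$, let $G$ be a finite $p$-group, and let $A=k[[x]]$, $K=k((x))$. Let $L$ be an étale $G$-Galois algebra over $K$, i.e. a commutative étale $K$-algebra of rank $\#G$ with an action of $G$ by $K$-algebra automorphisms such that $L^G=K$. Let $B$ be the integral closure of $A$ in $L$, and let $\mathfrak m_1,\dots,\mathfrak m_r$ be its maximal ideals (so $B\cong\prod_{i=1}^r k[[t_i]]$ and $L\cong\prod_{i=1}^r k((t_i))$). Let $\operatorname{ord}_{\mathfrak m_i}\colon L\to\mathbb Z\cup\{\infty\}$ be the composition of the projection $L\to k((t_i))$ with the $t_i$-adic valuation. For $j\ge 0$ put $$G_j=\{\sigma\in G:\ \sigma(b)\equiv b \bmod \mathfrak m_1^{\,j+1}\ \text{for all } b\in B\},\qquad d'=\sum_{j\ge 1}(\#G_j-1).$$ Assume $(*)$: $G_0$ is a normal subgroup of $G$. Call $z\in L$ a magical element for $L/K$ if $\operatorname{ord}_{\mathfrak m_i}(z)\ge -d'$ for all $i=1,\dots,r$ and $\operatorname{tr}_{L/K}(z)\in A^\times$. Then: 1. If $z\in L$ satisfies $\operatorname{ord}_{\mathfrak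 m_i}(z)\ge -d'$ for all $i$, with equality for exactly one $i$, then $z$ is a magical element for $L/K$. 2. $L/K$ has a magical element. -/

import Mathlib

open scoped LaurentSeries PowerSeries

noncomputable section

namespace MagicalElement

section Orders

variable {B : Type*} [CommRing B]

/-- The order of vanishing of `b` at `m`: the supremum of all `n` with `b ∈ m ^ n`. -/
def idealOrd (m : Ideal B) (b : B) : ℕ∞ := ⨆ (n : ℕ) (_ : b ∈ m ^ n), (n : ℕ∞)

variable (G : Type*) [Group G] [MulSemiringAction G B]

/-- The `j`-th ramification group (lower numbering) of `m`: all `σ ∈ G` with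
`σ b ≡ b mod m ^ (j + 1)` for every `b ∈ B`. -/
def ramificationGroup (m : Ideal B) (j : ℕ) : Subgroup G := (m ^ (j + 1)).inertia G

/-- `d' = ∑_{j ≥ 1} (#G_j - 1)`, where `G_j` is the `j`-th ramification group of `m`. -/
def dPrime (m : Ideal B) : ℕ := ∑ᶠ j : ℕ, (Nat.card (ramificationGroup G m (j + 1)) - 1)

end Orders

section Laurent

variable {k : Type*} [Field k] {L : Type*} [CommRing L] [Algebra k⸨X⸩ L]
  [Algebra k⟦X⟧ L] [IsScalarTower k⟦X⟧ k⸨X⸩ L]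

/-- An action by `k((x))`-algebra automorphisms is an action by `k[[x]]`-algebra automorphisms
(so it restricts to the integral closure of `k[[x]]`). -/
instance smulCommClass_powerSeries {G : Type*} [Group G] [MulSemiringAction G L]
    [SMulCommClass G k⸨X⸩ L] : SMulCommClass G k⟦X⟧ L where
  smul_comm g a z := by
    rw [← algebraMap_smul k⸨X⸩ a z, ← algebraMap_smul k⸨X⸩ a (g • z), smul_comm]

/-- Every element of an étale `k((x))`-algebra is of the form `b / x ^ n` with `b` integral over
`k[[x]]`. -/
theorem exists_X_pow_mul_mem [Algebra.Etale k⸨X⸩ L] (z : L) :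
    ∃ n : ℕ, algebraMap k⟦X⟧ L PowerSeries.X ^ n * z ∈ integralClosure k⟦X⟧ L := by
  have : Module.Finite k⸨X⸩ L := Algebra.FormallyUnramified.finite_of_free k⸨X⸩ L
  obtain ⟨⟨_, n, rfl⟩, h⟩ := IsIntegral.exists_multiple_integral_of_isLocalization
    (Submonoid.powers (PowerSeries.X : k⟦X⟧)) (Rₘ := k⸨X⸩) z (Algebra.IsIntegral.isIntegral z)
  refine ⟨n, ?_⟩
  rw [mem_integralClosure_iff]
  simpa [Submonoid.smul_def, Algebra.smul_def] using h

open Classical in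
/-- The valuation `ord_m : L → ℤ ∪ {∞}` attached to a maximal ideal `m` of the integral closure
`B` of `k[[x]]` in `L`. Writing `z = b / x ^ n` with `b ∈ B` (and `n` least possible), it is the
order of `b` at `m` minus `n` times the order of `x` at `m`. -/
def ord [Algebra.Etale k⸨X⸩ L] (m : Ideal (integralClosure k⟦X⟧ L)) (z : L) : WithTop ℤ :=
  let n : ℕ := Nat.find (exists_X_pow_mul_mem (k := k) z)
  let b : integralClosure k⟦X⟧ L := ⟨_, Nat.find_spec (exists_X_pow_mul_mem (k := k) z)⟩
  let e : ℕ := (idealOrd m (algebraMap k⟦X⟧ (integralClosure k⟦X⟧ L) PowerSeries.X)).toNat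
  ENat.map (fun a : ℕ => (a : ℤ)) (idealOrd m b) + ((-((n : ℤ) * (e : ℤ)) : ℤ) : WithTop ℤ)

/-- `z` is a magical element (with `d'` computed at the maximal ideal `m₁`): `ord_m z ≥ -d'` at
every maximal ideal `m` of `B`, and the trace of `z` is a unit of `k[[x]]`. -/
def IsMagical (G : Type*) [Group G] [MulSemiringAction G L] [SMulCommClass G k⸨X⸩ L]
    [Algebra.Etale k⸨X⸩ L] (m₁ : MaximalSpectrum (integralClosure k⟦X⟧ L)) (z : L) : Prop :=
  (∀ m : MaximalSpectrum (integralClosure k⟦X⟧ L),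
    ((-(dPrime G m₁.asIdeal : ℤ) : ℤ) : WithTop ℤ) ≤ ord m.asIdeal z) ∧
  ∃ u : k⟦X⟧ˣ, Algebra.trace k⸨X⸩ L z = algebraMap k⟦X⟧ k⸨X⸩ u

end Laurent

end MagicalElement

end

/-! Write A = k[[x]], B for the integral closure, P = `maximalProd c`, n = #G, r for the number of
maximal ideals of B and δ = #G_0. The point is that B = A[t] for a well-chosen t, which makes the
trace explicit through Euler's formula.

Since k is infinite, distinct constants c(m) can be attached to the maximal ideals, and the Chinese
remainder theorem gives t such that t - c(m) generates m for every m (`exists_forall_eq_span_sub`).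
All residue fields are k, so P(t) = ∏ (t - c(m)) generates the radical of B, and polynomials in t
over k exhaust B modulo any power of P(t). Because G permutes the maximal ideals transitively, the
characteristic polynomial F of t reduces to P^δ modulo x. Nakayama's lemma then shows that 1, t, …,
t^(n-1) span B, and a degree argument shows that x is P(t)^δ times a unit.

The derivative F'(t) is the product of the t - σt over σ ≠ 1; counting ramification groups
(Hilbert's formula) shows that it is P(t)^(d' + δ - 1) times a unit v. If z has poles of order at
most d', then w = P(t)^d' z lies in B and z F'(t) = P(t)^(δ-1) v w = g(t) with deg g < n. By Euler's
formula (`trace_eq_coeff`) the trace of z is the coefficient of g in degree n - 1. Modulo x, g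
becomes P^(δ-1) h with deg h < r, and h(c(m)) = 0 exactly when w ∈ m, that is, when ord_m z > -d'.
If equality holds at exactly one m, then h is nonzero with r - 1 distinct zeros, so its degree is
exactly r - 1; as n - 1 = (δ-1) r + (r-1), the trace has nonzero constant term. For existence, let w
be the product of the t - c(m) over m ≠ m₁. -/

noncomputable section
namespace MagicalElement

/-! ### The integral closure of k[[x]] in L. -/

section Concrete

variable {k : Type*} [Field k] {L : Type*} [CommRing L] [Algebra k⸨X⸩ L]
  [Algebra k⟦X⟧ L] [IsScalarTower k⟦X⟧ k⸨X⸩ L]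

variable (k L) in
-- An étale algebra over a field is a finite product of finite separable extensions, and the
-- integral closure embeds in the product of theirs, each finite over the Noetherian ring k[[x]].
theorem finite_integralClosure [Algebra.Etale k⸨X⸩ L] :
    Module.Finite k⟦X⟧ (integralClosure k⟦X⟧ L) := by
  obtain ⟨I, _, F, _, _, e, hF⟩ := (Algebra.Etale.iff_exists_algEquiv_prod k⸨X⸩ L).mp inferInstance
  let alg (i : I) : Algebra k⟦X⟧ (F i) := Algebra.compHom (F i) (algebraMap k⟦X⟧ k⸨X⸩)
  have tower (i : I) : IsScalarTower k⟦X⟧ k⸨X⸩ (F i) := .of_algebraMap_eq fun _ => rfl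
  have fin (i : I) : Module.Finite k⟦X⟧ (integralClosure k⟦X⟧ (F i)) := by
    have := (hF i).1
    have := (hF i).2
    exact IsIntegralClosure.finite k⟦X⟧ k⸨X⸩ (F i) (integralClosure k⟦X⟧ (F i))
  let e' : L →ₐ[k⟦X⟧] (∀ i, F i) := e.toAlgHom.restrictScalars k⟦X⟧
  let φ (i : I) : L →ₐ[k⟦X⟧] F i := (Pi.evalAlgHom k⟦X⟧ F i).comp e'
  let ψ : integralClosure k⟦X⟧ L →ₗ[k⟦X⟧] (∀ i, integralClosure k⟦X⟧ (F i)) :=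
    LinearMap.pi fun i => ((φ i).mapIntegralClosure).toLinearMap
  refine Module.Finite.of_injective ψ fun a b hab => Subtype.ext (e.injective ?_)
  ext i
  exact congrArg Subtype.val (congrFun hab i)

theorem isUnit_algebraMap_X : IsUnit (algebraMap k⟦X⟧ L PowerSeries.X) := by
  rw [IsScalarTower.algebraMap_apply k⟦X⟧ k⸨X⸩ L]
  refine IsUnit.map _ (IsUnit.mk0 _ ?_)
  simp

theorem exists_smul_coe_mem_integralClosure [Algebra.Etale k⸨X⸩ L] (z : L) :
    ∃ (n : ℕ) (b : integralClosure k⟦X⟧ L), algebraMap k⟦X⟧ L PowerSeries.X ^ n * z = b := by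
  obtain ⟨n, hn⟩ := exists_X_pow_mul_mem (k := k) z
  exact ⟨n, ⟨_, hn⟩, rfl⟩

variable {G : Type*} [Group G] [MulSemiringAction G L] [SMulCommClass G k⸨X⸩ L]

theorem isInvariant_integralClosure [Algebra.IsInvariant k⸨X⸩ L G] [Nontrivial L] :
    Algebra.IsInvariant k⟦X⟧ (integralClosure k⟦X⟧ L) G where
  isInvariant b hb := by
    obtain ⟨a, ha⟩ := Algebra.IsInvariant.isInvariant (A := k⸨X⸩) (G := G) (b : L) fun g => by
      rw [← integralClosure.coe_smul, hb]
    have hi : IsIntegral k⟦X⟧ a := by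
      rw [← isIntegral_algebraMap_iff (algebraMap k⸨X⸩ L).injective, ha]
      exact b.2
    obtain ⟨y, rfl⟩ := IsIntegrallyClosed.isIntegral_iff.mp hi
    exact ⟨y, Subtype.ext (by rw [← ha, ← IsScalarTower.algebraMap_apply]; rfl)⟩

end Concrete

/-! ### Maximal ideals over x and their residue fields. -/

section Residue

variable (k : Type*) [Field k] {B : Type*} [CommRing B] [Algebra k⟦X⟧ B]

section Integral

variable [Algebra.IsIntegral k⟦X⟧ B]

theorem under_eq_maximalIdeal (m : Ideal B) [m.IsMaximal] :
    m.under k⟦X⟧ = IsLocalRing.maximalIdeal k⟦X⟧ :=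
  IsLocalRing.eq_maximalIdeal (Ideal.isMaximal_comap_of_isIntegral_of_isMaximal m)

theorem algebraMap_X_mem (m : Ideal B) [m.IsMaximal] : algebraMap k⟦X⟧ B PowerSeries.X ∈ m := by
  change PowerSeries.X ∈ m.under k⟦X⟧
  rw [under_eq_maximalIdeal, PowerSeries.maximalIdeal_eq_span_X]
  exact Ideal.mem_span_singleton_self _

theorem isMaximal_of_algebraMap_X_mem (q : Ideal B) [q.IsPrime]
    (h : algebraMap k⟦X⟧ B PowerSeries.X ∈ q) : q.IsMaximal := by
  refine Ideal.isMaximal_of_isIntegral_of_isMaximal_comap (R := k⟦X⟧) q ?_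
  have : IsLocalRing.maximalIdeal k⟦X⟧ ≤ q.comap (algebraMap k⟦X⟧ B) := by
    rw [PowerSeries.maximalIdeal_eq_span_X, Ideal.span_singleton_le_iff_mem]
    exact h
  rw [← (IsLocalRing.maximalIdeal.isMaximal k⟦X⟧).eq_of_le (Ideal.IsPrime.ne_top inferInstance) this]
  exact IsLocalRing.maximalIdeal.isMaximal _

end Integral

section Constants

variable {k} [Algebra k B] [IsScalarTower k k⟦X⟧ B]

theorem algebraMap_X_dvd_sub_constantCoeff (a : k⟦X⟧) :
    algebraMap k⟦X⟧ B PowerSeries.X ∣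
      algebraMap k⟦X⟧ B a - algebraMap k B (PowerSeries.constantCoeff a) := by
  rw [IsScalarTower.algebraMap_apply k k⟦X⟧ B, ← map_sub]
  exact map_dvd _ (PowerSeries.X_dvd_iff.mpr (by simp))

open Polynomial in
theorem algebraMap_X_dvd_aeval_sub (q : k⟦X⟧[X]) (b : B) :
    algebraMap k⟦X⟧ B PowerSeries.X ∣
      aeval b q - aeval b (q.map PowerSeries.constantCoeff) := by
  induction q using Polynomial.induction_on' with
  | add p q hp hq =>
    rw [Polynomial.map_add, map_add, map_add, add_sub_add_comm]
    exact dvd_add hp hq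
  | monomial n a =>
    rw [Polynomial.map_monomial, aeval_monomial, aeval_monomial, ← sub_mul]
    exact (algebraMap_X_dvd_sub_constantCoeff a).mul_right _

open Polynomial in
-- Modulo m, b is a root of the reduction over k of a monic equation; this reduction splits into
-- linear factors, and m is prime.
theorem exists_sub_algebraMap_mem [Algebra.IsIntegral k⟦X⟧ B] [IsAlgClosed k]
    (m : Ideal B) [m.IsMaximal] (b : B) :
    ∃ c : k, b - algebraMap k B c ∈ m := by
  obtain ⟨q, hq, hqb⟩ := Algebra.IsIntegral.isIntegral (R := k⟦X⟧) b
  have hmem : aeval b (q.map PowerSeries.constantCoeff) ∈ m := by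
    have := m.mem_of_dvd (algebraMap_X_dvd_aeval_sub q b) (algebraMap_X_mem k m)
    rw [show aeval b q = 0 from hqb, zero_sub] at this
    simpa using this
  have hsplit := (IsAlgClosed.splits (q.map (PowerSeries.constantCoeff (R := k)))).eq_prod_roots
  rw [(hq.map _).leadingCoeff, C_1, one_mul] at hsplit
  rw [hsplit, map_multiset_prod, Ideal.IsPrime.multiset_prod_mem_iff_exists_mem inferInstance] at hmem
  simp only [Multiset.map_map, Multiset.mem_map] at hmem
  obtain ⟨_, ⟨c, -, rfl⟩, hc⟩ := hmem
  exact ⟨c, by simpa using hc⟩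

end Constants

end Residue

/-! ### Transitivity of G on the maximal ideals. -/

section Transitivity

open Pointwise

theorem exists_eq_smul (k : Type*) [Field k] {B : Type*} [CommRing B] [Algebra k⟦X⟧ B]
    (G : Type*) [Group G] [Finite G] [MulSemiringAction G B] [SMulCommClass G k⟦X⟧ B]
    [Algebra.IsInvariant k⟦X⟧ B G] [Algebra.IsIntegral k⟦X⟧ B]
    (m m' : Ideal B) [m.IsMaximal] [m'.IsMaximal] : ∃ g : G, m' = g • m :=
  Algebra.IsInvariant.exists_smul_of_under_eq k⟦X⟧ B G _ _
    ((under_eq_maximalIdeal k m).trans (under_eq_maximalIdeal k m').symm)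

theorem finite_maximalSpectrum (k : Type*) [Field k] (B : Type*) [CommRing B] [Algebra k⟦X⟧ B]
    (G : Type*) [Group G] [Finite G] [MulSemiringAction G B] [SMulCommClass G k⟦X⟧ B]
    [Algebra.IsInvariant k⟦X⟧ B G] [Algebra.IsIntegral k⟦X⟧ B] :
    Finite (MaximalSpectrum B) := by
  cases isEmpty_or_nonempty (MaximalSpectrum B) with
  | inl h => infer_instance
  | inr h =>
    obtain ⟨m⟩ := h
    have := m.isMaximal
    have hsurj : Set.univ ⊆ MaximalSpectrum.asIdeal ⁻¹' (Set.range fun g : G => g • m.asIdeal) := by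
      intro m' _
      have := m'.isMaximal
      obtain ⟨g, hg⟩ := exists_eq_smul k G m.asIdeal m'.asIdeal
      exact ⟨g, hg.symm⟩
    exact Set.finite_univ_iff.mp (((Set.finite_range _).preimage
      (fun _ _ _ _ h => MaximalSpectrum.ext h)).subset hsurj)

end Transitivity

end MagicalElement
end

noncomputable section
namespace MagicalElement

/-! ### Principality of the maximal ideals. -/

section Principal

variable {B : Type*} [CommRing B]

/-- As primes containing x are maximal, m is minimal over (x), hence an associated prime of B/(x):
it annihilates the class of some b. The fraction b/x then carries m into B without lying in B. -/
theorem exists_not_dvd_forall_dvd_mul [IsNoetherianRing B] {x : B} {m : Ideal B} [m.IsMaximal]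
    (hx : x ∈ m) (hmin : ∀ q : Ideal B, q.IsPrime → x ∈ q → q.IsMaximal) :
    ∃ b : B, ¬ x ∣ b ∧ ∀ a ∈ m, x ∣ b * a := by
  have hm : m ∈ (Module.annihilator B (B ⧸ Ideal.span {x})).minimalPrimes := by
    rw [Ideal.annihilator_quotient]
    refine ⟨⟨inferInstance, by simpa [Ideal.span_le] using hx⟩, fun q hq hqm => ?_⟩
    have := hmin q hq.1 (hq.2 (Ideal.mem_span_singleton_self x))
    exact (this.eq_of_le (Ideal.IsPrime.ne_top inferInstance) hqm).ge
  obtain ⟨-, y, hy⟩ := (isAssociatedPrime_iff).mp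
    (Module.associatedPrimes.minimalPrimes_annihilator_subset_associatedPrimes _ _ hm)
  obtain ⟨b, rfl⟩ := Ideal.Quotient.mk_surjective y
  have key (a : B) : a ∈ m ↔ x ∣ b * a := by
    rw [hy, Submodule.mem_colon_singleton, Submodule.mem_bot, ← Ideal.mem_span_singleton,
      ← Ideal.Quotient.eq_zero_iff_mem, mul_comm, map_mul]
    rfl
  refine ⟨b, fun h => ?_, fun a ha => (key a).mp ha⟩
  exact Ideal.IsPrime.one_notMem (I := m) inferInstance ((key 1).mpr (by simpa using h))

/-- If y = b/x carried m into itself, Cayley–Hamilton would make y integral over B, hence an element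
of B, contradicting x ∤ b. -/
theorem exists_mul_eq_mul_notMem [IsNoetherianRing B] {L : Type*} [CommRing L] [Algebra B L]
    (hinj : Function.Injective (algebraMap B L))
    (hcl : ∀ z : L, IsIntegral B z → ∃ b : B, algebraMap B L b = z)
    {x b : B} (hx : IsUnit (algebraMap B L x)) {m : Ideal B} (hxm : x ∈ m) (hb : ¬ x ∣ b)
    (hbm : ∀ a ∈ m, x ∣ b * a) : ∃ s ∈ m, ∃ c ∉ m, b * s = x * c := by
  by_contra! hcon
  obtain ⟨u, hu⟩ := hx
  set y : L := ↑u⁻¹ * algebraMap B L b with hy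
  have hxy : algebraMap B L x * y = algebraMap B L b := by
    rw [hy, ← hu, Units.mul_inv_cancel_left]
  refine hb ?_
  let N : Submodule B L := Submodule.map (Algebra.linearMap B L) m
  have hN : ∀ n ∈ N, LinearMap.mulLeft B y n ∈ N := by
    rintro _ ⟨a, ha, rfl⟩
    obtain ⟨c, hc⟩ := hbm a ha
    refine ⟨c, by_contra fun hcm => hcon a ha c hcm hc, ?_⟩
    simp only [Algebra.linearMap_apply, LinearMap.mulLeft_apply]
    rw [hy, mul_assoc, ← map_mul, hc, map_mul, ← hu, Units.inv_mul_cancel_left]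
  have : Module.Finite B N := Module.Finite.iff_fg.mpr ((IsNoetherian.noetherian m).map (Algebra.linearMap B L))
  obtain ⟨q, hq, hq0⟩ := LinearMap.exists_monic_and_aeval_eq_zero B
    ((LinearMap.mulLeft B y).restrict hN)
  have happly (q : Polynomial B) (n : N) :
      ((Polynomial.aeval ((LinearMap.mulLeft B y).restrict hN) q n : N) : L)
        = Polynomial.aeval y q * n := by
    induction q using Polynomial.induction_on' with
    | add p q hp hq => simp [hp, hq, add_mul]
    | monomial i a =>
      simp only [Polynomial.aeval_monomial, Module.End.mul_apply, Module.algebraMap_end_apply,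
        Submodule.coe_smul, Algebra.smul_def, mul_assoc]
      congr 1
      induction i with
      | zero => simp
      | succ i ih =>
        rw [pow_succ', Module.End.mul_apply, pow_succ', mul_assoc, ← ih]
        rfl
  have hroot : Polynomial.aeval y q = 0 := by
    -- Since m contains x, a unit of L, a polynomial in y that kills m is zero in L.
    have := happly q ⟨algebraMap B L x, x, hxm, rfl⟩
    rw [hq0] at this
    refine (hu ▸ u.isUnit : IsUnit (algebraMap B L x)).mul_left_eq_zero.mp ?_
    exact this.symm
  obtain ⟨c, hc⟩ := hcl y ⟨q, hq, hroot⟩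
  exact ⟨c, hinj (by rw [map_mul, hc, hxy])⟩

/-- The fraction b/x carries m² into m, but carries s to c. -/
theorem notMem_sq_of_mul_eq_mul {x b s c : B} (hx : x ∈ nonZeroDivisors B) {m : Ideal B}
    (hbm : ∀ a ∈ m, x ∣ b * a) (hc : c ∉ m) (hbs : b * s = x * c) : s ∉ m ^ 2 := by
  intro hs
  have key : ∀ r ∈ m ^ 2, ∃ d ∈ m, b * r = x * d := by
    intro r hr
    rw [pow_two] at hr
    induction hr using Submodule.mul_induction_on' with
    | mem_mul_mem a ha a' ha' =>
      obtain ⟨d, hd⟩ := hbm a ha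
      exact ⟨d * a', m.mul_mem_left _ ha', by rw [← mul_assoc, hd, mul_assoc]⟩
    | add r _ r' _ h h' =>
      obtain ⟨d, hd, e⟩ := h
      obtain ⟨d', hd', e'⟩ := h'
      exact ⟨d + d', m.add_mem hd hd', by rw [mul_add, e, e', mul_add]⟩
  obtain ⟨d, hd, e⟩ := key s hs
  rw [hbs] at e
  rw [(mul_cancel_left_mem_nonZeroDivisors hx).mp e] at hc
  exact hc hd

/-- Let d = (b/x)t. If d were in m, then tc = sd and the invertibility of c modulo m would put t in
m². So d ∉ m. For a ∈ m the colon ideal (t) : a contains t and d; only m could be a maximal ideal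
above it, and m omits d. -/
theorem eq_span_singleton_of_notMem_sq {x b s c : B} (hx : x ∈ nonZeroDivisors B) {m : Ideal B}
    [hm : m.IsMaximal] (hbm : ∀ a ∈ m, x ∣ b * a) (hs : s ∈ m) (hc : c ∉ m) (hbs : b * s = x * c)
    {t : B} (htm : t ∈ m) (ht : t ∉ m ^ 2) (ht' : ∀ n : Ideal B, n.IsMaximal → t ∈ n → n = m) :
    m = Ideal.span {t} := by
  refine le_antisymm (fun a ha => ?_) (by simpa [Ideal.span_le] using htm)
  obtain ⟨d, hd⟩ := hbm t htm
  have hdm : d ∉ m := by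
    intro hdm
    obtain ⟨u, v, hv, huv⟩ := Ideal.IsMaximal.exists_inv hm hc
    have h1 : t * c = s * d := (mul_cancel_left_mem_nonZeroDivisors hx).mp <| by
      linear_combination s * hd - t * hbs
    refine ht ?_
    have h2 : t = s * (d * u) + t * v := by linear_combination u * h1 - t * huv
    rw [h2, pow_two]
    exact add_mem (Ideal.mul_mem_mul hs (m.mul_mem_right _ hdm)) (Ideal.mul_mem_mul htm hv)
  by_contra hcon
  have hne : (Ideal.span {t}).colon ({a} : Set B) ≠ ⊤ := by
    rw [Ne, Ideal.eq_top_iff_one, Submodule.mem_colon_singleton]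
    simpa using hcon
  obtain ⟨n, hn, hle⟩ := Ideal.exists_le_maximal _ hne
  have htn : t ∈ n := hle (by
    rw [Submodule.mem_colon_singleton]
    exact Ideal.mul_mem_right _ _ (Ideal.mem_span_singleton_self t))
  have hdn : d ∈ n := hle (by
    rw [Submodule.mem_colon_singleton, Ideal.mem_span_singleton]
    obtain ⟨e, he⟩ := hbm a ha
    refine ⟨e, (mul_cancel_left_mem_nonZeroDivisors hx).mp ?_⟩
    simp only [smul_eq_mul]
    linear_combination t * he - a * hd)
  exact hdm (ht' n hn htn ▸ hdn)

end Principal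

end MagicalElement
end

noncomputable section
namespace MagicalElement

/-! ### Orders of vanishing at principal maximal ideals. -/

section IdealOrd

variable {B : Type*} [CommRing B]

theorem coe_le_idealOrd_iff {m : Ideal B} {b : B} {n : ℕ} :
    (n : ℕ∞) ≤ idealOrd m b ↔ b ∈ m ^ n := by
  refine ⟨fun h => ?_, fun h => le_iSup₂_of_le n h le_rfl⟩
  by_contra hb
  obtain _ | n := n
  · simp at hb
  have : idealOrd m b ≤ (n : ℕ∞) := by
    refine iSup₂_le fun i hi => ?_
    by_contra! hlt
    rw [Nat.cast_lt] at hlt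
    exact hb (Ideal.pow_le_pow_right hlt hi)
  have := h.trans this
  rw [Nat.cast_le] at this
  omega

theorem idealOrd_eq_of_forall_mem_iff {m m' : Ideal B} {b b' : B}
    (h : ∀ n, b ∈ m ^ n ↔ b' ∈ m' ^ n) : idealOrd m b = idealOrd m' b' := by
  simp only [idealOrd, h]

theorem idealOrd_eq_zero_iff {m : Ideal B} {b : B} : idealOrd m b = 0 ↔ b ∉ m := by
  rw [← not_iff_not, not_not, ← Ne, ← Order.one_le_iff_ne_zero, ← Nat.cast_one,
    coe_le_idealOrd_iff, pow_one]

variable {π : B}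

theorem isCoprime_of_notMem {m : Ideal B} [m.IsMaximal] (hm : m = Ideal.span {π}) {c : B}
    (hc : c ∉ m) : IsCoprime π c := by
  obtain ⟨u, v, hv, huv⟩ := Ideal.IsMaximal.exists_inv ‹_› hc
  rw [hm, Ideal.mem_span_singleton] at hv
  obtain ⟨w, rfl⟩ := hv
  exact ⟨w, u, by linear_combination huv⟩

theorem idealOrd_mul_of_notMem {m : Ideal B} [m.IsMaximal] (hm : m = Ideal.span {π}) {c : B}
    (hc : c ∉ m) (b : B) : idealOrd m (c * b) = idealOrd m b := by
  refine idealOrd_eq_of_forall_mem_iff fun n => ⟨fun h => ?_, fun h => Ideal.mul_mem_left _ _ h⟩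
  rw [hm, Ideal.span_singleton_pow, Ideal.mem_span_singleton] at h ⊢
  exact (isCoprime_of_notMem hm hc).pow_left.dvd_of_dvd_mul_left h

theorem idealOrd_pow_mul {m : Ideal B} (hm : m = Ideal.span {π}) (hπ : π ∈ nonZeroDivisors B)
    (s : ℕ) (b : B) : idealOrd m (π ^ s * b) = s + idealOrd m b := by
  have key (n : ℕ) : ((s + n : ℕ) : ℕ∞) ≤ idealOrd m (π ^ s * b) ↔ (n : ℕ∞) ≤ idealOrd m b := by
    rw [coe_le_idealOrd_iff, coe_le_idealOrd_iff, hm, Ideal.span_singleton_pow,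
      Ideal.span_singleton_pow, Ideal.mem_span_singleton, Ideal.mem_span_singleton, pow_add]
    exact ⟨fun ⟨c, hc⟩ => ⟨c, (mul_cancel_left_mem_nonZeroDivisors (pow_mem hπ s)).mp
      (by rw [hc, mul_assoc])⟩, fun h => mul_dvd_mul_left _ h⟩
  have hs : (s : ℕ∞) ≤ idealOrd m (π ^ s * b) := by
    simpa using (key 0).mpr
  refine le_antisymm ?_ ?_
  · refine ENat.forall_natCast_le_iff_le.mp fun n hn => ?_
    obtain h | h := le_total n s
    · exact le_add_right (Nat.cast_le.mpr h)
    · obtain ⟨j, rfl⟩ := Nat.exists_eq_add_of_le h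
      rw [Nat.cast_add]
      gcongr
      exact (key j).mp hn
  · refine ENat.forall_natCast_le_iff_le.mp fun n hn => ?_
    obtain h | h := le_total n s
    · exact (Nat.cast_le.mpr h).trans hs
    · obtain ⟨j, rfl⟩ := Nat.exists_eq_add_of_le h
      rw [key]
      rw [Nat.cast_add] at hn
      exact (ENat.add_le_add_iff_left (ENat.natCast_ne_top s)).mp hn

theorem exists_eq_pow_mul_of_idealOrd_eq {m : Ideal B} (hm : m = Ideal.span {π}) {b : B} {s : ℕ}
    (hπ : π ∈ nonZeroDivisors B) (h : idealOrd m b = s) : ∃ c ∉ m, b = π ^ s * c := by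
  have h1 : b ∈ m ^ s := coe_le_idealOrd_iff.mp h.ge
  rw [hm, Ideal.span_singleton_pow, Ideal.mem_span_singleton] at h1
  obtain ⟨c, rfl⟩ := h1
  refine ⟨c, ?_, rfl⟩
  rw [idealOrd_pow_mul hm hπ] at h
  rw [← idealOrd_eq_zero_iff]
  exact (ENat.add_right_injective_of_ne_top (ENat.natCast_ne_top s)) (h.trans (add_zero _).symm)

theorem idealOrd_mul {m : Ideal B} [m.IsMaximal] (hm : m = Ideal.span {π})
    (hπ : π ∈ nonZeroDivisors B) (a b : B) :
    idealOrd m (a * b) = idealOrd m a + idealOrd m b := by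
  cases ha : idealOrd m a with
  | top =>
    rw [top_add]
    refine ENat.eq_top_iff_forall_ge.mpr fun n => ?_
    exact coe_le_idealOrd_iff.mpr (Ideal.mul_mem_right _ _ (coe_le_idealOrd_iff.mp (by simp [ha])))
  | coe s =>
    obtain ⟨c, hc, rfl⟩ := exists_eq_pow_mul_of_idealOrd_eq hm hπ ha
    rw [mul_assoc, idealOrd_pow_mul hm hπ, idealOrd_mul_of_notMem hm hc]

theorem idealOrd_prod {m : Ideal B} [m.IsMaximal] (hm : m = Ideal.span {π})
    (hπ : π ∈ nonZeroDivisors B) {α : Type*} (s : Finset α) (f : α → B) :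
    idealOrd m (∏ i ∈ s, f i) = ∑ i ∈ s, idealOrd m (f i) := by
  classical
  induction s using Finset.induction_on with
  | empty =>
    rw [Finset.prod_empty, Finset.sum_empty, idealOrd_eq_zero_iff]
    exact Ideal.IsPrime.one_notMem inferInstance
  | insert a s ha ih => rw [Finset.prod_insert ha, Finset.sum_insert ha, idealOrd_mul hm hπ, ih]

end IdealOrd

section Uniformizers

variable {B : Type*} [CommRing B]

theorem isUnit_of_forall_notMem {b : B} (h : ∀ m : MaximalSpectrum B, b ∉ m.asIdeal) : IsUnit b := by
  by_contra hb
  obtain ⟨m, hm, hbm⟩ := exists_max_ideal_of_mem_nonunits hb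
  exact h ⟨m, hm⟩ hbm

variable [Fintype (MaximalSpectrum B)] {π : MaximalSpectrum B → B}

theorem prod_erase_notMem [DecidableEq (MaximalSpectrum B)]
    (hπ : ∀ m, m.asIdeal = Ideal.span {π m}) (m : MaximalSpectrum B) :
    ∏ n ∈ Finset.univ.erase m, π n ∉ m.asIdeal := by
  rw [Ideal.IsPrime.prod_mem_iff]
  rintro ⟨n, hn, hmem⟩
  refine (Finset.mem_erase.mp hn).1 (MaximalSpectrum.ext (n.isMaximal.eq_of_le
    (Ideal.IsPrime.ne_top m.isMaximal.isPrime) ?_))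
  rw [hπ n, Ideal.span_singleton_le_iff_mem]
  exact hmem

theorem idealOrd_prod_pow_mul (hπ : ∀ m, m.asIdeal = Ideal.span {π m})
    (hreg : ∀ m, π m ∈ nonZeroDivisors B) (m : MaximalSpectrum B) (s : ℕ) (b : B) :
    idealOrd m.asIdeal ((∏ n, π n) ^ s * b) = s + idealOrd m.asIdeal b := by
  classical
  have := m.isMaximal
  rw [← Finset.mul_prod_erase _ _ (Finset.mem_univ m), mul_pow, mul_assoc,
    idealOrd_pow_mul (hπ m) (hreg m), idealOrd_mul_of_notMem (hπ m)]
  exact fun h => prod_erase_notMem hπ m (Ideal.IsPrime.mem_of_pow_mem inferInstance _ h)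

theorem prod_pow_dvd_of_forall_mem (hπ : ∀ m, m.asIdeal = Ideal.span {π m}) {s : ℕ} {b : B}
    (h : ∀ m : MaximalSpectrum B, b ∈ m.asIdeal ^ s) : (∏ n, π n) ^ s ∣ b := by
  rw [← Finset.prod_pow]
  refine Finset.prod_dvd_of_coprime (fun m _ n _ hmn => ?_) fun m _ => ?_
  · have := m.isMaximal
    refine (isCoprime_of_notMem (hπ m) fun hmem => hmn ?_).pow
    refine (MaximalSpectrum.ext (n.isMaximal.eq_of_le
      (Ideal.IsPrime.ne_top m.isMaximal.isPrime) ?_)).symm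
    rwa [hπ n, Ideal.span_singleton_le_iff_mem]
  · have := h m
    rwa [hπ m, Ideal.span_singleton_pow, Ideal.mem_span_singleton] at this

end Uniformizers
end MagicalElement
end

noncomputable section
namespace MagicalElement

open Polynomial

/-! ### A common coordinate t, and B modulo powers of P(t). -/

section MaximalProd

variable {k : Type*} [Field k] {B : Type*} [CommRing B] [Fintype (MaximalSpectrum B)]

/-- The product of the `X - c m` over all maximal ideals `m`. -/
def maximalProd (c : MaximalSpectrum B → k) : k[X] := ∏ m, (X - C (c m))

theorem monic_maximalProd (c : MaximalSpectrum B → k) : (maximalProd c).Monic := monic_prod_X_sub_C _ _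

theorem natDegree_maximalProd (c : MaximalSpectrum B → k) :
    (maximalProd c).natDegree = Fintype.card (MaximalSpectrum B) := by
  rw [maximalProd, natDegree_prod_of_monic _ _ fun m _ => monic_X_sub_C _]
  simp

end MaximalProd

section Approximation

variable {k : Type*} [Field k] {B : Type*} [CommRing B] [Algebra k B]
  {t : B} {c : MaximalSpectrum B → k}

/-- Take the c(m) distinct and t ≡ c(m) + s(m) modulo m². Then t - c(m) lies in m but not in m², and
in no other maximal ideal n, since there t ≡ c(n) and c(m) - c(n) is a unit. -/
theorem exists_forall_eq_span_sub [Infinite k] [Finite (MaximalSpectrum B)]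
    {x : B} (hx : x ∈ nonZeroDivisors B)
    (h : ∀ m : MaximalSpectrum B, ∃ b, (∀ a ∈ m.asIdeal, x ∣ b * a) ∧
      ∃ s ∈ m.asIdeal, ∃ d ∉ m.asIdeal, b * s = x * d) :
    ∃ (t : B) (c : MaximalSpectrum B → k), Function.Injective c ∧
      ∀ m, m.asIdeal = Ideal.span {t - algebraMap k B (c m)} := by
  obtain ⟨N, ⟨e⟩⟩ := Finite.exists_equiv_fin (MaximalSpectrum B)
  let c (m : MaximalSpectrum B) : k := Infinite.natEmbedding k (e m)
  have hc : Function.Injective c := fun m n hmn =>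
    e.injective (Fin.val_injective ((Infinite.natEmbedding k).injective hmn))
  choose b hb s hs d hd hbs using h
  have hne {m n : MaximalSpectrum B} (hmn : m ≠ n) : IsCoprime m.asIdeal n.asIdeal :=
    have := m.isMaximal
    have := n.isMaximal
    Ideal.isCoprime_of_isMaximal fun h => hmn (MaximalSpectrum.ext h)
  obtain ⟨t, ht⟩ := Ideal.exists_forall_sub_mem_ideal
    (I := fun m : MaximalSpectrum B => m.asIdeal ^ 2) (fun m n hmn => (hne hmn).pow)
    (fun m => algebraMap k B (c m) + s m)
  have htm (m : MaximalSpectrum B) : t - algebraMap k B (c m) ∈ m.asIdeal := by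
    have := m.asIdeal.add_mem (Ideal.pow_le_self two_ne_zero (ht m)) (hs m)
    convert! this using 1
    ring
  refine ⟨t, c, hc, fun m => ?_⟩
  have := m.isMaximal
  refine eq_span_singleton_of_notMem_sq hx (hb m) (hs m) (hd m) (hbs m) (htm m) (fun h => ?_)
    fun n hn htn => ?_
  · refine notMem_sq_of_mul_eq_mul hx (hb m) (hd m) (hbs m) ?_
    convert! (m.asIdeal ^ 2).sub_mem h (ht m) using 1
    ring
  · by_contra hnm
    have hcc : algebraMap k B (c m - c ⟨n, hn⟩) ∈ n := by
      convert! n.sub_mem (htm ⟨n, hn⟩) htn using 1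
      rw [map_sub]
      ring
    refine hn.ne_top (Ideal.eq_top_of_isUnit_mem _ hcc (IsUnit.map _ (IsUnit.mk0 _ ?_)))
    rw [sub_ne_zero]
    exact fun h => hnm (congrArg MaximalSpectrum.asIdeal (hc h)).symm

theorem aeval_mem_iff_eval_eq_zero {m : Ideal B} (hm : m ≠ ⊤) {a : k}
    (h : t - algebraMap k B a ∈ m) (q : k[X]) : aeval t q ∈ m ↔ q.eval a = 0 := by
  have hsub : aeval t q - algebraMap k B (q.eval a) ∈ m := by
    obtain ⟨r, hr⟩ := X_sub_C_dvd_sub_C_eval (a := a) (p := q)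
    have := congrArg (aeval t) hr
    rw [map_sub, map_mul, map_sub, aeval_X, aeval_C, aeval_C] at this
    rw [this]
    exact m.mul_mem_right _ h
  refine ⟨fun hq => ?_, fun hq => by simpa [hq] using hsub⟩
  by_contra hne
  refine hm (Ideal.eq_top_of_isUnit_mem _ ?_ ((IsUnit.mk0 _ hne).map (algebraMap k B)))
  simpa using m.sub_mem hq hsub

theorem sub_algebraMap_mem (hspan : ∀ m, m.asIdeal = Ideal.span {t - algebraMap k B (c m)})
    (m : MaximalSpectrum B) : t - algebraMap k B (c m) ∈ m.asIdeal := by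
  rw [hspan]
  exact Ideal.mem_span_singleton_self _

variable [Fintype (MaximalSpectrum B)]
  (hc : Function.Injective c) (hspan : ∀ m, m.asIdeal = Ideal.span {t - algebraMap k B (c m)})

theorem aeval_maximalProd :
    aeval t (maximalProd c) = ∏ m, (t - algebraMap k B (c m)) := by
  simp [maximalProd]

include hspan in
theorem aeval_maximalProd_dvd_iff {b : B} :
    aeval t (maximalProd c) ∣ b ↔ ∀ m : MaximalSpectrum B, b ∈ m.asIdeal := by
  rw [aeval_maximalProd]
  refine ⟨fun h m => ?_, fun h => ?_⟩
  · rw [hspan, Ideal.mem_span_singleton]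
    exact (Finset.dvd_prod_of_mem _ (Finset.mem_univ m)).trans h
  · simpa using prod_pow_dvd_of_forall_mem hspan (s := 1) (by simpa using h)

include hc hspan in
theorem maximalProd_dvd_of_aeval_dvd {q : k[X]} (h : aeval t (maximalProd c) ∣ aeval t q) :
    maximalProd c ∣ q := by
  rw [aeval_maximalProd_dvd_iff hspan] at h
  refine Finset.prod_dvd_of_coprime (fun m _ n _ hmn => ?_) fun m _ => ?_
  · exact pairwise_coprime_X_sub_C hc hmn
  · rw [dvd_iff_isRoot, IsRoot]
    exact (aeval_mem_iff_eval_eq_zero m.isMaximal.ne_top (sub_algebraMap_mem hspan m) q).mp (h m)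

include hc hspan in
-- Injectivity of k[X]/(P^s) → B/(P(t)^s), one factor of P at a time: q(t) ∈ m means q(c(m)) = 0.
theorem maximalProd_pow_dvd_of_aeval_dvd (hreg : aeval t (maximalProd c) ∈ nonZeroDivisors B)
    {s : ℕ} {q : k[X]} (h : aeval t (maximalProd c) ^ s ∣ aeval t q) :
    maximalProd c ^ s ∣ q := by
  induction s generalizing q with
  | zero => simp
  | succ s ih =>
    obtain ⟨q, rfl⟩ := maximalProd_dvd_of_aeval_dvd hc hspan ((dvd_pow_self _ s.succ_ne_zero).trans h)
    rw [pow_succ']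
    refine mul_dvd_mul_left _ (ih ?_)
    obtain ⟨b, hb⟩ := h
    refine ⟨b, (mul_cancel_left_mem_nonZeroDivisors hreg).mp ?_⟩
    rw [← map_mul, hb]
    ring

include hc hspan in
-- Surjectivity of k[X]/(P^s) → B/(P(t)^s): the next P(t)-adic digit is determined by its residues
-- in k at the maximal ideals, and Lagrange interpolation at the c(m) realizes them.
theorem exists_aeval_maximalProd_pow_dvd_sub
    (hk : ∀ (m : MaximalSpectrum B) (b : B), ∃ c : k, b - algebraMap k B c ∈ m.asIdeal)
    (s : ℕ) (b : B) : ∃ q : k[X], aeval t (maximalProd c) ^ s ∣ b - aeval t q := by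
  classical
  induction s with
  | zero => simp
  | succ s ih =>
    obtain ⟨q, b', hb'⟩ := ih
    choose v hv using fun m => hk m b'
    let r := Lagrange.interpolate Finset.univ c v
    have hr : aeval t (maximalProd c) ∣ b' - aeval t r := by
      rw [aeval_maximalProd_dvd_iff hspan]
      intro m
      have h1 : aeval t (r - C (v m)) ∈ m.asIdeal := by
        rw [aeval_mem_iff_eval_eq_zero m.isMaximal.ne_top (sub_algebraMap_mem hspan m), eval_sub,
          eval_C, Lagrange.eval_interpolate_at_node _ hc.injOn (Finset.mem_univ m), sub_self]
      convert! m.asIdeal.sub_mem (hv m) h1 using 1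
      rw [map_sub, aeval_C]
      ring
    refine ⟨q + maximalProd c ^ s * r, ?_⟩
    have : b - aeval t (q + maximalProd c ^ s * r)
        = aeval t (maximalProd c) ^ s * (b' - aeval t r) := by
      rw [map_add, map_mul, map_pow]
      linear_combination hb'
    rw [this, pow_succ]
    exact mul_dvd_mul_left _ hr

end Approximation

end MagicalElement
end

noncomputable section
namespace MagicalElement

open Polynomial Pointwise

/-! ### Decomposition groups and the reduction of the characteristic polynomial. -/

section Stabilizer

theorem card_smul_eq (k : Type*) [Field k] {B : Type*} [CommRing B] [Algebra k⟦X⟧ B]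
    {G : Type*} [Group G] [MulSemiringAction G B] [SMulCommClass G k⟦X⟧ B]
    [Finite G] [Algebra.IsInvariant k⟦X⟧ B G] [Algebra.IsIntegral k⟦X⟧ B]
    (m n : Ideal B) [m.IsMaximal] [n.IsMaximal] :
    Nat.card {g : G // g⁻¹ • m = n} = Nat.card (MulAction.stabilizer G m) := by
  obtain ⟨g, rfl⟩ := exists_eq_smul k G m n
  refine Nat.card_congr ((Equiv.mulRight g).subtypeEquiv fun h => ?_)
  rw [Equiv.coe_mulRight, MulAction.mem_stabilizer_iff, mul_smul, inv_smul_eq_iff]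
  exact eq_comm

theorem exists_monic_map_eq_charpoly (k : Type*) [Field k] {B : Type*} [CommRing B]
    [Algebra k⟦X⟧ B] {G : Type*} [Group G] [MulSemiringAction G B]
    [Fintype G] [Algebra.IsInvariant k⟦X⟧ B G] [Nontrivial B]
    (t : B) : ∃ F : k⟦X⟧[X], F.Monic ∧ F.natDegree = Nat.card G ∧
      F.map (algebraMap k⟦X⟧ B) = MulSemiringAction.charpoly G t := by
  obtain ⟨F, h1, h2, h3⟩ := lifts_and_natDegree_eq_and_monic
    (Algebra.IsInvariant.charpoly_mem_lifts k⟦X⟧ B G t) (MulSemiringAction.monic_charpoly G t)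
  refine ⟨F, h3, ?_, h1⟩
  rw [h2, MulSemiringAction.charpoly_eq, natDegree_prod_of_monic _ _ fun m _ => monic_X_sub_C _]
  simp

variable {k : Type*} [Field k] {B : Type*} [CommRing B] [Algebra k⟦X⟧ B]
  [Algebra k B] [IsScalarTower k k⟦X⟧ B]
  {G : Type*} [Group G] [MulSemiringAction G B] [SMulCommClass G k⟦X⟧ B]

theorem smul_algebraMap_const (g : G) (a : k) : g • algebraMap k B a = algebraMap k B a := by
  rw [IsScalarTower.algebraMap_apply k k⟦X⟧ B, smul_algebraMap]

/-- G fixes the constants, which fill the residue field, so decomposition and inertia groups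
coincide. -/
theorem ramificationGroup_zero_eq_stabilizer {m : Ideal B}
    (hk : ∀ b : B, ∃ c : k, b - algebraMap k B c ∈ m) :
    ramificationGroup G m 0 = MulAction.stabilizer G m := by
  rw [ramificationGroup, zero_add, pow_one]
  refine le_antisymm (Ideal.inertia_le_stabilizer m) fun g hg b => ?_
  obtain ⟨c, hc⟩ := hk b
  have h1 : g • (b - algebraMap k B c) ∈ m := by
    have := Ideal.smul_mem_pointwise_smul g _ _ hc
    rwa [MulAction.mem_stabilizer_iff.mp hg] at this
  have := m.sub_mem h1 hc
  rwa [smul_sub, smul_algebraMap_const, sub_sub_sub_cancel_right] at this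

/-- From t ≡ c(g⁻¹m) modulo g⁻¹m it follows that gt ≡ c(g⁻¹m) modulo m. By transitivity each maximal
ideal is g⁻¹m for as many g as the stabilizer of m has elements. -/
theorem map_constantCoeff_eq_maximalProd_pow [Fintype G] [Algebra.IsInvariant k⟦X⟧ B G]
    [Algebra.IsIntegral k⟦X⟧ B] [Fintype (MaximalSpectrum B)] {t : B} {c : MaximalSpectrum B → k}
    (hspan : ∀ m, m.asIdeal = Ideal.span {t - algebraMap k B (c m)}) {F : k⟦X⟧[X]}
    (hF : F.map (algebraMap k⟦X⟧ B) = MulSemiringAction.charpoly G t) (m : MaximalSpectrum B) :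
    F.map PowerSeries.constantCoeff
      = maximalProd c ^ Nat.card (MulAction.stabilizer G m.asIdeal) := by
  classical
  have := m.isMaximal
  let r := Ideal.Quotient.mk m.asIdeal
  let M (g : G) : MaximalSpectrum B := ⟨g⁻¹ • m.asIdeal,
    Ideal.map_isMaximal_of_equiv (MulSemiringAction.toRingEquiv G B g⁻¹)⟩
  have h1 : (F.map PowerSeries.constantCoeff).map (r.comp (algebraMap k B))
      = (∏ g : G, (X - C (c (M g)))).map (r.comp (algebraMap k B)) := by
    have h2 : (r.comp (algebraMap k B)).comp PowerSeries.constantCoeff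
        = r.comp (algebraMap k⟦X⟧ B) := by
      refine RingHom.ext fun a => (Ideal.Quotient.eq.mpr ?_).symm
      exact Ideal.mem_of_dvd _ (algebraMap_X_dvd_sub_constantCoeff a) (algebraMap_X_mem k m.asIdeal)
    rw [Polynomial.map_map, h2, ← Polynomial.map_map, hF, MulSemiringAction.charpoly_eq,
      Polynomial.map_prod, Polynomial.map_prod]
    refine Finset.prod_congr rfl fun g _ => ?_
    simp only [Polynomial.map_sub, map_X, map_C, RingHom.comp_apply]
    congr 2
    refine Ideal.Quotient.eq.mpr ?_
    have := Ideal.smul_mem_pointwise_smul g _ _ (sub_algebraMap_mem hspan (M g))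
    rwa [smul_sub, smul_algebraMap_const, smul_inv_smul] at this
  rw [map_injective _ (RingHom.injective _) h1, maximalProd, ← Finset.prod_pow,
    ← Finset.prod_fiberwise Finset.univ M]
  refine Finset.prod_congr rfl fun n _ => ?_
  have := n.isMaximal
  rw [Finset.prod_congr rfl (g := fun _ => X - C (c n))
    fun g hg => by rw [(Finset.mem_filter.mp hg).2], Finset.prod_const,
    ← card_smul_eq k m.asIdeal n.asIdeal, Nat.card_eq_fintype_card, Fintype.card_subtype]
  simp only [M, MaximalSpectrum.ext_iff]

end Stabilizer

/-! ### Conjugation invariance of d'. -/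

section Ramification

variable {B : Type*} [CommRing B] {G : Type*} [Group G] [MulSemiringAction G B]

theorem mem_ramificationGroup_smul_iff (m : Ideal B) (j : ℕ) (g σ : G) :
    g * σ * g⁻¹ ∈ ramificationGroup G (g • m) j ↔ σ ∈ ramificationGroup G m j := by
  have hpow : (g • m) ^ (j + 1) = g • m ^ (j + 1) := by
    rw [Ideal.pointwise_smul_def, Ideal.pointwise_smul_def, Ideal.map_pow]
  constructor
  · intro h b
    have := h (g • b)
    rw [hpow, mul_smul, mul_smul, inv_smul_smul, ← smul_sub] at this
    exact (Ideal.smul_mem_pointwise_smul_iff).mp this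
  · intro h b
    rw [hpow, mul_smul, mul_smul]
    have := Ideal.smul_mem_pointwise_smul g _ _ (h (g⁻¹ • b))
    rwa [smul_sub, smul_inv_smul] at this

theorem card_ramificationGroup_smul (m : Ideal B) (j : ℕ) (g : G) :
    Nat.card (ramificationGroup G (g • m) j) = Nat.card (ramificationGroup G m j) :=
  (Nat.card_congr ((MulAut.conj g).toEquiv.subtypeEquiv fun σ => by
    rw [← mem_ramificationGroup_smul_iff m j g σ]
    rfl)).symm

theorem dPrime_smul (m : Ideal B) (g : G) : dPrime G (g • m) = dPrime G m := by
  simp only [dPrime, card_ramificationGroup_smul]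

end Ramification

end MagicalElement
end

noncomputable section
namespace MagicalElement

/-! ### Hilbert's different formula. -/

section Hilbert

theorem mem_ramificationGroup_iff {B : Type*} [CommRing B] {G : Type*} [Group G]
    [MulSemiringAction G B] {m : Ideal B} {t : B} {j : ℕ} {σ : G}
    (hgen : ∀ b : B, t - σ • t ∣ σ • b - b) :
    σ ∈ ramificationGroup G m j ↔ ((j + 1 : ℕ) : ℕ∞) ≤ idealOrd m (t - σ • t) := by
  rw [coe_le_idealOrd_iff]
  refine ⟨fun h => ?_, fun h b => Ideal.mem_of_dvd _ (hgen b) h⟩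
  rw [← neg_sub]
  exact neg_mem (h t)

/-- Each s(a) counts the levels from 1 to s(a). Level 1 is kept apart because it will correspond to
G_0, whereas d' starts at G_1. -/
theorem sum_eq_finsum_card_add_card {α : Type*} (S : Finset α) (s : α → ℕ) :
    ∑ a ∈ S, s a = ∑ᶠ j : ℕ, (S.filter fun a => j + 2 ≤ s a).card
      + (S.filter fun a => 1 ≤ s a).card := by
  have hsupp : (Function.support fun j : ℕ => (S.filter fun a => j + 2 ≤ s a).card) ⊆
      Finset.range (S.sup s) := by
    intro j hj
    obtain ⟨a, ha⟩ := Finset.card_ne_zero.mp hj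
    rw [Finset.mem_filter] at ha
    have := Finset.le_sup (f := s) ha.1
    simp only [Finset.coe_range, Set.mem_Iio]
    omega
  rw [finsum_eq_sum_of_support_subset _ hsupp]
  simp only [Finset.card_filter]
  rw [Finset.sum_comm, ← Finset.sum_add_distrib]
  refine Finset.sum_congr rfl fun a ha => ?_
  have hle := Finset.le_sup (f := s) ha
  rw [← Finset.card_filter, show (Finset.range (S.sup s)).filter (fun j => j + 2 ≤ s a)
    = Finset.range (s a - 1) by
      ext j
      simp only [Finset.mem_filter, Finset.mem_range]
      omega, Finset.card_range]
  split_ifs <;> omega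

variable {B : Type*} [CommRing B] {G : Type*} [Group G] [Fintype G] [DecidableEq G]
  [MulSemiringAction G B]

/-- Hilbert's formula for the exponent of the different. -/
theorem idealOrd_prod_sub_smul {m : Ideal B} [m.IsMaximal] {π : B} (hm : m = Ideal.span {π})
    (hπ : π ∈ nonZeroDivisors B) {t : B} (hgen : ∀ (σ : G) (b : B), t - σ • t ∣ σ • b - b)
    (hfin : idealOrd m (∏ σ ∈ Finset.univ.erase (1 : G), (t - σ • t)) ≠ ⊤) :
    idealOrd m (∏ σ ∈ Finset.univ.erase (1 : G), (t - σ • t))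
      = ((dPrime G m + (Nat.card (ramificationGroup G m 0) - 1) : ℕ) : ℕ∞) := by
  rw [idealOrd_prod hm hπ] at hfin ⊢
  have hfin' : ∀ σ ∈ Finset.univ.erase (1 : G), idealOrd m (t - σ • t) ≠ ⊤ :=
    fun σ hσ h => hfin (ENat.sum_eq_top.mpr ⟨σ, hσ, h⟩)
  have hs : ∀ σ ∈ Finset.univ.erase (1 : G),
      idealOrd m (t - σ • t) = ((idealOrd m (t - σ • t)).toNat : ℕ∞) :=
    fun σ hσ => (ENat.natCast_toNat (hfin' σ hσ)).symm
  -- The subtracted 1 is the identity, which is also the σ left out of the product.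
  have hcard (j : ℕ) : Nat.card (ramificationGroup G m j) - 1
      = ((Finset.univ.erase (1 : G)).filter
          fun σ => j + 1 ≤ (idealOrd m (t - σ • t)).toNat).card := by
    classical
    rw [Nat.card_eq_fintype_card, Fintype.card_subtype,
      ← Finset.card_erase_of_mem (Finset.mem_filter.mpr ⟨Finset.mem_univ 1, one_mem _⟩),
      Finset.filter_erase]
    congr 1
    ext σ
    simp only [Finset.mem_erase, Finset.mem_filter, Finset.mem_univ, true_and]
    refine and_congr_right fun hσ => ?_
    rw [mem_ramificationGroup_iff (hgen σ), hs σ (by simpa using hσ), Nat.cast_le,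
      ENat.toNat_natCast]
  rw [Finset.sum_congr rfl hs, ← Nat.cast_sum, sum_eq_finsum_card_add_card, dPrime, hcard 0]
  simp only [hcard]

end Hilbert

end MagicalElement
end

noncomputable section
namespace MagicalElement

open Polynomial

/-! ### Euler's trace formula and simplicity of the roots. -/

section Trace

theorem smul_aeval {K : Type*} [CommSemiring K] {L : Type*} [CommRing L] [Algebra K L]
    {G : Type*} [Group G] [MulSemiringAction G L] [SMulCommClass G K L]
    (σ : G) (y : L) (q : K[X]) : σ • aeval y q = aeval (σ • y) q :=
  (aeval_algHom_apply (MulSemiringAction.toAlgHom K L σ) y q).symm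

variable {K : Type*} [Field K] {L : Type*} [CommRing L] [Algebra K L]

/-- The Vandermonde matrix of the images of the generator is invertible and conjugates the matrix of
multiplication by z to the diagonal matrix of the ψ i z. -/
theorem algebraMap_trace_eq_sum {E : Type*} [Field E] [Algebra K E] (pb : PowerBasis K L)
    {ι : Type*} [Fintype ι] (hcard : Fintype.card ι = pb.dim) (ψ : ι → L →ₐ[K] E)
    (hinj : Function.Injective fun i => ψ i pb.gen) (z : L) :
    algebraMap K E (Algebra.trace K L z) = ∑ i, ψ i z := by
  classical
  let e : Fin pb.dim ≃ ι := (Fintype.equivFinOfCardEq hcard).symm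
  let V : Matrix (Fin pb.dim) (Fin pb.dim) E := Matrix.vandermonde fun i => ψ (e i) pb.gen
  let M := (Algebra.leftMulMatrix pb.basis z).map (algebraMap K E)
  have hV : IsUnit V.det := by
    rw [isUnit_iff_ne_zero, Matrix.det_vandermonde_ne_zero_iff]
    exact hinj.comp e.injective
  have hVM : V * M = Matrix.diagonal (fun i => ψ (e i) z) * V := by
    ext i j
    have := congrArg (ψ (e i)) (pb.basis.sum_repr (z * pb.basis j))
    rw [Matrix.diagonal_mul, Matrix.mul_apply]
    simp only [V, M, Matrix.vandermonde_apply, Matrix.map_apply, Algebra.leftMulMatrix_eq_repr_mul]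
    rw [map_mul (ψ (e i)), map_sum] at this
    simp only [map_smul, pb.basis_eq_pow, map_pow] at this
    rw [pb.basis_eq_pow, ← this]
    exact Finset.sum_congr rfl fun l _ => by rw [Algebra.smul_def, mul_comm]
  have hM : M = V⁻¹ * (Matrix.diagonal (fun i => ψ (e i) z) * V) := by
    rw [← hVM, Matrix.nonsing_inv_mul_cancel_left _ _ hV]
  calc algebraMap K E (Algebra.trace K L z) = M.trace := by
        rw [Algebra.trace_eq_matrix_trace pb.basis]
        exact (AddMonoidHom.map_trace (algebraMap K E).toAddMonoidHom _)
    _ = ∑ i, ψ (e i) z := by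
        rw [hM, Matrix.trace_mul_comm, Matrix.mul_nonsing_inv_cancel_right _ _ hV,
          Matrix.trace_diagonal]
    _ = ∑ i, ψ i z := e.sum_comp fun i => ψ i z

/-- Euler's formula for the trace of `g(τ) / F'(τ)`. -/
theorem trace_eq_coeff {G : Type*} [Group G] [Fintype G] [MulSemiringAction G L]
    [SMulCommClass G K L] (pb : PowerBasis K L) (hdim : pb.dim = Nat.card G) {F : K[X]}
    (hF : F.map (algebraMap K L) = MulSemiringAction.charpoly G pb.gen)
    (hunit : IsUnit (aeval pb.gen (derivative F))) {g : K[X]} (hg : g.degree < Nat.card G) {z : L}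
    (hz : z * aeval pb.gen (derivative F) = aeval pb.gen g) :
    Algebra.trace K L z = g.coeff (Nat.card G - 1) := by
  classical
  have hnt : Nontrivial L := by
    refine Module.nontrivial_of_finrank_pos (R := K) ?_
    rw [pb.finrank, hdim]
    exact Nat.card_pos
  -- L need not be a field; following the automorphisms by one residue map gives homomorphisms to a
  -- field, which separate the generator because F' is a unit there.
  obtain ⟨m, hm⟩ := Ideal.exists_maximal L
  let := Ideal.Quotient.field m
  let φ : L →ₐ[K] L ⧸ m := Ideal.Quotient.mkₐ K m
  let ψ (σ : G) : L →ₐ[K] L ⧸ m := φ.comp (MulSemiringAction.toAlgHom K L σ)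
  let v (σ : G) : L ⧸ m := ψ σ pb.gen
  have hnodal : F.map (algebraMap K (L ⧸ m)) = Lagrange.nodal Finset.univ v := by
    have := congrArg (Polynomial.map (φ : L →+* L ⧸ m)) hF
    rw [Polynomial.map_map, AlgHom.comp_algebraMap, MulSemiringAction.charpoly_eq,
      Polynomial.map_prod] at this
    rw [this, Lagrange.nodal]
    refine Finset.prod_congr rfl fun σ _ => ?_
    rw [Polynomial.map_sub, map_X, map_C]
    rfl
  have hψ (σ : G) (q : K[X]) : ψ σ (aeval pb.gen q) = (q.map (algebraMap K (L ⧸ m))).eval (v σ) := by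
    rw [eval_map_algebraMap, aeval_algHom_apply]
  have hder (σ : G) : ψ σ (aeval pb.gen (derivative F))
      = ∏ ρ ∈ Finset.univ.erase σ, (v σ - v ρ) := by
    rw [hψ, ← derivative_map, hnodal, Lagrange.eval_nodal_derivative_eval_node_eq (Finset.mem_univ σ),
      Lagrange.eval_nodal]
  have hne (σ : G) : ∏ ρ ∈ Finset.univ.erase σ, (v σ - v ρ) ≠ 0 := by
    rw [← hder]
    exact (hunit.map (ψ σ)).ne_zero
  have hinj : Function.Injective v := by
    intro σ ρ h
    by_contra hσρ
    exact hne σ (Finset.prod_eq_zero (Finset.mem_erase.mpr ⟨Ne.symm hσρ, Finset.mem_univ ρ⟩)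
      (sub_eq_zero.mpr h))
  refine (algebraMap K (L ⧸ m)).injective ?_
  rw [algebraMap_trace_eq_sum pb (by rw [hdim, Nat.card_eq_fintype_card]) ψ hinj z]
  -- The top coefficient of the interpolation of g is the sum of g(v σ) / ∏ (v σ - v ρ), whose
  -- denominators are the values of F'.
  have hcoeff := Lagrange.coeff_eq_sum (s := Finset.univ) hinj.injOn
    (P := g.map (algebraMap K (L ⧸ m))) (by
      rw [Finset.card_univ, ← Nat.card_eq_fintype_card, degree_map]
      exact hg)
  rw [Finset.card_univ, ← Nat.card_eq_fintype_card, coeff_map] at hcoeff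
  rw [hcoeff]
  refine Finset.sum_congr rfl fun σ _ => ?_
  rw [eq_div_iff (hne σ), ← hder, ← hψ, ← map_mul, hz]

/-- A root of the minimal polynomial generating an unramified algebra is simple. -/
theorem isUnit_aeval_derivative [Algebra.FormallyUnramified K L] (pb : PowerBasis K L) {F : K[X]}
    (hF : minpoly K pb.gen = F) : IsUnit (aeval pb.gen (derivative F)) := by
  set D := aeval pb.gen (derivative F) with hD
  let R := L ⧸ Ideal.span {D}
  let φ : L →ₐ[K] R := Ideal.Quotient.mkₐ K _
  let ι : R →ₐ[K] DualNumber R := TrivSqZeroExt.inlAlgHom K R R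
  -- Over R = L/(F'(τ)), F(τ + ε) = F(τ) + F'(τ)ε = 0. So τ ↦ τ and τ ↦ τ + ε lift the same map
  -- across a square-zero ideal; unramifiedness forces ε = 0, hence R = 0.
  let y : DualNumber R := ι (φ pb.gen) + DualNumber.eps
  have hD0 : φ D = 0 := Ideal.Quotient.eq_zero_iff_mem.mpr (Ideal.mem_span_singleton_self D)
  have hy : aeval y (minpoly K pb.gen) = 0 := by
    rw [aeval_add_of_sq_eq_zero _ _ _ (by rw [pow_two, DualNumber.eps_mul_eps]), hF,
      aeval_algHom_apply, aeval_algHom_apply, aeval_algHom_apply, aeval_algHom_apply, ← hD, hD0,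
      ← hF, minpoly.aeval]
    simp
  have heq : ι.comp φ = pb.lift y hy := by
    refine Algebra.FormallyUnramified.lift_unique' (TrivSqZeroExt.fstHom K R R)
      ⟨2, TrivSqZeroExt.kerIdeal_sq (R := R) (M := R)⟩ _ _ (pb.algHom_ext ?_)
    rw [AlgHom.comp_apply, AlgHom.comp_apply, AlgHom.comp_apply, pb.lift_gen]
    simp [y, ι]
  have h0 := AlgHom.congr_fun heq pb.gen
  rw [pb.lift_gen, AlgHom.comp_apply, left_eq_add] at h0
  have h1 : (1 : R) = 0 := by simpa using congrArg TrivSqZeroExt.snd h0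
  have : Subsingleton R := subsingleton_of_zero_eq_one h1.symm
  rw [← Ideal.span_singleton_eq_top]
  exact Ideal.Quotient.subsingleton_iff.mp this

end Trace

end MagicalElement
end

noncomputable section
namespace MagicalElement

open Polynomial Pointwise

/-! ### Generation of B by t, and the ramification index. -/

section Monogenic

theorem idealOrd_smul_algebraMap {A B : Type*} [CommRing A] [CommRing B] [Algebra A B]
    {G : Type*} [Group G] [MulSemiringAction G B] [SMulCommClass G A B]
    (m : Ideal B) (g : G) (a : A) :
    idealOrd (g • m) (algebraMap A B a) = idealOrd m (algebraMap A B a) := by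
  refine idealOrd_eq_of_forall_mem_iff fun n => ?_
  have hpow : (g • m) ^ n = g • m ^ n := by
    rw [Ideal.pointwise_smul_def, Ideal.pointwise_smul_def, Ideal.map_pow]
  rw [hpow, ← Ideal.smul_mem_pointwise_smul_iff (a := g) (S := m ^ n), smul_algebraMap]

theorem sub_algebraMap_mem_nonZeroDivisors {k : Type*} [Field k] {B : Type*} [CommRing B]
    [Algebra k⟦X⟧ B] [Algebra k B] {t : B} {c : MaximalSpectrum B → k} [Algebra.IsIntegral k⟦X⟧ B]
    (hspan : ∀ m, m.asIdeal = Ideal.span {t - algebraMap k B (c m)})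
    (hX : algebraMap k⟦X⟧ B PowerSeries.X ∈ nonZeroDivisors B) (m : MaximalSpectrum B) :
    t - algebraMap k B (c m) ∈ nonZeroDivisors B := by
  have := m.isMaximal
  have h := algebraMap_X_mem k m.asIdeal
  rw [hspan, Ideal.mem_span_singleton] at h
  obtain ⟨b, hb⟩ := h
  exact (mul_mem_nonZeroDivisors.mp (hb ▸ hX)).1

theorem aeval_maximalProd_mem_nonZeroDivisors {k : Type*} [Field k] {B : Type*} [CommRing B]
    [Algebra k⟦X⟧ B] [Algebra k B] [Fintype (MaximalSpectrum B)] {t : B}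
    {c : MaximalSpectrum B → k} [Algebra.IsIntegral k⟦X⟧ B]
    (hspan : ∀ m, m.asIdeal = Ideal.span {t - algebraMap k B (c m)})
    (hX : algebraMap k⟦X⟧ B PowerSeries.X ∈ nonZeroDivisors B) :
    aeval t (maximalProd c) ∈ nonZeroDivisors B := by
  rw [aeval_maximalProd]
  exact prod_mem fun m _ => sub_algebraMap_mem_nonZeroDivisors hspan hX m

variable {k : Type*} [Field k] {B : Type*} [CommRing B] [Algebra k⟦X⟧ B]
  [Algebra k B] [IsScalarTower k k⟦X⟧ B] [Fintype (MaximalSpectrum B)]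
  {t : B} {c : MaximalSpectrum B → k}

variable {F : k⟦X⟧[X]} {δ : ℕ}

theorem algebraMap_X_dvd_aeval_maximalProd_pow (hF0 : aeval t F = 0)
    (hF : F.map PowerSeries.constantCoeff = maximalProd c ^ δ) :
    algebraMap k⟦X⟧ B PowerSeries.X ∣ aeval t (maximalProd c) ^ δ := by
  have := algebraMap_X_dvd_aeval_sub F t
  rwa [hF0, hF, zero_sub, dvd_neg, map_pow] at this

/-- Nakayama's lemma for k[[x]][t] inside B: x divides P(t)^δ, modulo which every element is a
polynomial in t over k. Division by F bounds the degree. -/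
theorem exists_degree_lt_aeval_eq [Module.Finite k⟦X⟧ B] (hc : Function.Injective c)
    (hspan : ∀ m, m.asIdeal = Ideal.span {t - algebraMap k B (c m)})
    (hk : ∀ (m : MaximalSpectrum B) (b : B), ∃ c : k, b - algebraMap k B c ∈ m.asIdeal)
    (hmonic : F.Monic) (hF0 : aeval t F = 0)
    (hF : F.map PowerSeries.constantCoeff = maximalProd c ^ δ) (b : B) :
    ∃ q : k⟦X⟧[X], q.degree < F.natDegree ∧ aeval t q = b := by
  have htop : (⊤ : Submodule k⟦X⟧ B) ≤ LinearMap.range (aeval (R := k⟦X⟧) t).toLinearMap := by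
    refine Submodule.le_of_le_smul_of_le_jacobson_bot (I := IsLocalRing.maximalIdeal k⟦X⟧)
      Module.Finite.fg_top (IsLocalRing.maximalIdeal_le_jacobson _) fun b _ => ?_
    obtain ⟨q, hq⟩ := exists_aeval_maximalProd_pow_dvd_sub hc hspan hk δ b
    obtain ⟨d, hd⟩ := (algebraMap_X_dvd_aeval_maximalProd_pow hF0 hF).trans hq
    rw [← add_sub_cancel (aeval t q) b, hd, ← Algebra.smul_def]
    refine Submodule.add_mem_sup ⟨q.map (algebraMap k k⟦X⟧), ?_⟩
      (Submodule.smul_mem_smul ?_ Submodule.mem_top)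
    · exact aeval_map_algebraMap k⟦X⟧ t q
    · rw [PowerSeries.maximalIdeal_eq_span_X]
      exact Ideal.mem_span_singleton_self _
  obtain ⟨q, hq⟩ := htop (Submodule.mem_top (x := b))
  refine ⟨q %ₘ F, ?_, ?_⟩
  · rw [← degree_eq_natDegree hmonic.ne_zero]
    exact degree_modByMonic_lt _ hmonic
  · exact (aeval_modByMonic_eq_self_of_root hF0).trans hq

variable {G : Type*} [Group G] [MulSemiringAction G B] [SMulCommClass G k⟦X⟧ B]

/-- All ramification indices are equal to `δ`. -/
theorem exists_unit_mul_eq_algebraMap_X [Finite G] [Algebra.IsInvariant k⟦X⟧ B G]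
    [Module.Finite k⟦X⟧ B] (hc : Function.Injective c)
    (hspan : ∀ m, m.asIdeal = Ideal.span {t - algebraMap k B (c m)})
    (hk : ∀ (m : MaximalSpectrum B) (b : B), ∃ c : k, b - algebraMap k B c ∈ m.asIdeal)
    (hX : algebraMap k⟦X⟧ B PowerSeries.X ∈ nonZeroDivisors B)
    (hmonic : F.Monic) (hF0 : aeval t F = 0)
    (hF : F.map PowerSeries.constantCoeff = maximalProd c ^ δ)
    (hind : ∀ q : k⟦X⟧[X], q.degree < F.natDegree → aeval t q = 0 → q = 0)
    (m : MaximalSpectrum B) :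
    ∃ u : Bˣ, algebraMap k⟦X⟧ B PowerSeries.X = aeval t (maximalProd c) ^ δ * u := by
  have hreg := sub_algebraMap_mem_nonZeroDivisors hspan hX
  set x := algebraMap k⟦X⟧ B PowerSeries.X with hx
  have hord (n : MaximalSpectrum B) (s : ℕ) (b : B) :
      idealOrd n.asIdeal (aeval t (maximalProd c) ^ s * b) = s + idealOrd n.asIdeal b := by
    rw [aeval_maximalProd]
    exact idealOrd_prod_pow_mul hspan hreg n s b
  have hmul (n : MaximalSpectrum B) (a b : B) :
      idealOrd n.asIdeal (a * b) = idealOrd n.asIdeal a + idealOrd n.asIdeal b :=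
    have := n.isMaximal
    idealOrd_mul (hspan n) (hreg n) a b
  have hone : idealOrd m.asIdeal (1 : B) = 0 :=
    idealOrd_eq_zero_iff.mpr (Ideal.IsPrime.one_notMem m.isMaximal.isPrime)
  obtain ⟨d, hd⟩ := algebraMap_X_dvd_aeval_maximalProd_pow hF0 hF
  have hsum : idealOrd m.asIdeal x + idealOrd m.asIdeal d = δ := by
    rw [← hmul, ← hd, ← mul_one (_ ^ δ), hord, hone, add_zero]
  obtain ⟨e, he⟩ := ENat.ne_top_iff_exists.mp
    (ne_top_of_le_ne_top (ENat.natCast_ne_top δ) (hsum ▸ le_self_add))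
  have heδ : e ≤ δ := by
    rw [← Nat.cast_le (α := ℕ∞), he, ← hsum]
    exact le_self_add
  -- G fixes x and is transitive on maximal ideals.
  have hall (n : MaximalSpectrum B) : idealOrd n.asIdeal x = e := by
    have := m.isMaximal
    have := n.isMaximal
    obtain ⟨g, hg⟩ := exists_eq_smul k G m.asIdeal n.asIdeal
    rw [hg, hx, idealOrd_smul_algebraMap, he]
  obtain ⟨u, hu⟩ : aeval t (maximalProd c) ^ e ∣ x := by
    rw [aeval_maximalProd]
    exact prod_pow_dvd_of_forall_mem hspan fun n => coe_le_idealOrd_iff.mp (hall n).ge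
  have hunit : IsUnit u := isUnit_of_forall_notMem fun n => by
    have := hall n
    rw [hu, hord] at this
    rw [← idealOrd_eq_zero_iff]
    exact (ENat.add_right_injective_of_ne_top (ENat.natCast_ne_top e)) (this.trans (add_zero _).symm)
  obtain ⟨u, rfl⟩ := hunit
  obtain rfl | hlt := heδ.eq_or_lt
  · exact ⟨u, hu⟩
  -- If e < δ, write u⁻¹ = g(t) with deg g < deg F. Then P^e - x g kills t and has degree < deg F,
  -- so it is zero; but its reduction modulo x is the monic P^e.
  exfalso
  obtain ⟨g, hg, hgu⟩ := exists_degree_lt_aeval_eq hc hspan hk hmonic hF0 hF (↑u⁻¹ : B)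
  have hr : 0 < (maximalProd c).natDegree := by
    rw [natDegree_maximalProd]
    exact Fintype.card_pos_iff.mpr ⟨m⟩
  have hdeg : F.natDegree = δ * (maximalProd c).natDegree := by
    rw [← hmonic.natDegree_map PowerSeries.constantCoeff, hF, (monic_maximalProd c).natDegree_pow]
  have hq := hind ((maximalProd c ^ e).map (algebraMap k k⟦X⟧) - (PowerSeries.X : k⟦X⟧) • g) ?_ ?_
  · have := congrArg (Polynomial.map PowerSeries.constantCoeff) hq
    rw [Polynomial.map_sub, Polynomial.map_smul, PowerSeries.constantCoeff_X, zero_smul,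
      sub_zero, Polynomial.map_map, Polynomial.map_zero] at this
    exact ((monic_maximalProd c).pow e |>.map _).ne_zero this
  · refine (degree_sub_le _ _).trans_lt (max_lt ?_ ((degree_smul_le _ _).trans_lt hg))
    refine degree_map_le.trans_lt ?_
    rw [degree_eq_natDegree ((monic_maximalProd c).pow e).ne_zero,
      (monic_maximalProd c).natDegree_pow, hdeg, Nat.cast_lt]
    exact Nat.mul_lt_mul_of_pos_right hlt hr
  · rw [map_sub, map_smul, aeval_map_algebraMap, Algebra.smul_def, ← hx, hu, hgu, map_pow, mul_assoc,
      Units.mul_inv, mul_one, sub_self]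

end Monogenic

end MagicalElement
end

noncomputable section
namespace MagicalElement

open Polynomial Pointwise

/-! ### Power basis of L, the derivative F'(t), and the top coefficient. -/

section Generator

variable {k : Type*} [Field k] {B : Type*} [CommRing B] [Algebra k⟦X⟧ B]
  {L : Type*} [CommRing L] [Algebra k⸨X⸩ L] [Algebra k⟦X⟧ L] [IsScalarTower k⟦X⟧ k⸨X⸩ L]
  [Algebra B L] [IsScalarTower k⟦X⟧ B L] {t : B} {n : ℕ}

theorem exists_powerBasis
    (hden : ∀ z : L, ∃ (N : ℕ) (b : B), algebraMap k⟦X⟧ L PowerSeries.X ^ N * z = algebraMap B L b)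
    (hgen : ∀ b : B, ∃ q : k⟦X⟧[X], q.degree < n ∧ aeval t q = b)
    (hrank : Module.finrank k⸨X⸩ L = n) :
    ∃ pb : PowerBasis k⸨X⸩ L, pb.dim = n ∧ pb.gen = algebraMap B L t := by
  let v (i : Fin n) : L := algebraMap B L t ^ (i : ℕ)
  have hv : ⊤ ≤ Submodule.span k⸨X⸩ (Set.range v) := by
    intro z _
    obtain ⟨N, b, hb⟩ := hden z
    obtain ⟨q, hq, rfl⟩ := hgen b
    have hmem : algebraMap B L (aeval t q) ∈ Submodule.span k⸨X⸩ (Set.range v) := by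
      rw [← aeval_algebraMap_apply, aeval_def, eval₂_eq_sum]
      refine Submodule.sum_mem _ fun i hi => ?_
      change algebraMap k⟦X⟧ L (q.coeff i) * _ ∈ _
      rw [IsScalarTower.algebraMap_apply k⟦X⟧ k⸨X⸩ L, ← Algebra.smul_def]
      refine Submodule.smul_mem _ _ (Submodule.subset_span ⟨⟨i, ?_⟩, rfl⟩)
      exact_mod_cast (le_degree_of_mem_supp i hi).trans_lt hq
    rw [← hb, IsScalarTower.algebraMap_apply k⟦X⟧ k⸨X⸩ L, ← map_pow, ← Algebra.smul_def] at hmem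
    refine (Submodule.smul_mem_iff _ (pow_ne_zero N ?_)).mp hmem
    simp
  refine ⟨⟨algebraMap B L t, n, basisOfTopLeSpanOfCardEqFinrank v hv (by simp [hrank]), ?_⟩, rfl, rfl⟩
  simp [v]

theorem eq_zero_of_aeval_eq_zero (pb : PowerBasis k⸨X⸩ L) (hgen : pb.gen = algebraMap B L t)
    {q : k⟦X⟧[X]} (hq : q.degree < pb.dim) (h : aeval t q = 0) : q = 0 := by
  by_contra hne
  have hinj : Function.Injective (algebraMap k⟦X⟧ k⸨X⸩) := FaithfulSMul.algebraMap_injective _ _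
  have := pb.dim_le_degree_of_root (p := q.map (algebraMap k⟦X⟧ k⸨X⸩))
    ((Polynomial.map_ne_zero_iff hinj).mpr hne) (by
      rw [aeval_map_algebraMap, hgen, aeval_algebraMap_apply, h, map_zero])
  exact absurd (this.trans degree_map_le) (not_le.mpr hq)

theorem minpoly_gen_eq (pb : PowerBasis k⸨X⸩ L) (hgen : pb.gen = algebraMap B L t)
    {F : k⟦X⟧[X]} (hF : F.Monic) (hdeg : F.natDegree = pb.dim) (h : aeval t F = 0) :
    minpoly k⸨X⸩ pb.gen = F.map (algebraMap k⟦X⟧ k⸨X⸩) := by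
  refine (eq_of_monic_of_dvd_of_natDegree_le (minpoly.monic pb.isIntegral_gen) (hF.map _)
    (minpoly.dvd _ _ ?_) ?_).symm
  · rw [aeval_map_algebraMap, hgen, aeval_algebraMap_apply, h, map_zero]
  · rw [hF.natDegree_map, hdeg, pb.natDegree_minpoly]

end Generator

section Different

theorem aeval_derivative_eq_prod {A B : Type*} [CommRing A] [CommRing B] [Algebra A B]
    {G : Type*} [Group G] [Fintype G] [DecidableEq G] [MulSemiringAction G B] {t : B} {F : A[X]}
    (hF : F.map (algebraMap A B) = MulSemiringAction.charpoly G t) :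
    aeval t (derivative F) = ∏ σ ∈ Finset.univ.erase (1 : G), (t - σ • t) := by
  have h : F.map (algebraMap A B) = Lagrange.nodal Finset.univ fun σ : G => σ • t := hF
  have h1 := Lagrange.eval_nodal_derivative_eval_node_eq (v := fun σ : G => σ • t)
    (Finset.mem_univ (1 : G))
  simp only [one_smul] at h1
  rw [← eval_map_algebraMap, ← derivative_map, h, h1, Lagrange.eval_nodal]

theorem sub_smul_dvd_smul_sub {A B : Type*} [CommRing A] [CommRing B] [Algebra A B]
    {G : Type*} [Group G] [MulSemiringAction G B] [SMulCommClass G A B] {t b : B} {q : A[X]}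
    (hq : aeval t q = b) (σ : G) : t - σ • t ∣ σ • b - b := by
  rw [← hq, smul_aeval, dvd_sub_comm, ← eval_map_algebraMap, ← eval_map_algebraMap]
  exact sub_dvd_eval_sub _ _ _

end Different

section Leading

variable {k : Type*} [Field k] {B : Type*} [CommRing B] [Algebra k B]
  [Fintype (MaximalSpectrum B)] {t : B} {c : MaximalSpectrum B → k}

/-- Here δ plays the role of the ramification index minus one. Write q = P^δ h with deg h < deg P.
As h vanishes at every c(m) except c(m₁), its degree is exactly deg P - 1, so the coefficient is the
leading one. -/
theorem coeff_ne_zero_of_aeval_eq (hc : Function.Injective c)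
    (hspan : ∀ m, m.asIdeal = Ideal.span {t - algebraMap k B (c m)})
    (hreg : aeval t (maximalProd c) ∈ nonZeroDivisors B) {δ : ℕ} {q : k[X]} {w : B}
    (hdeg : q.degree < ((δ + 1) * (maximalProd c).natDegree : ℕ))
    (hq : aeval t q = aeval t (maximalProd c) ^ δ * w) {m₁ : MaximalSpectrum B}
    (hw₁ : w ∉ m₁.asIdeal) (hw : ∀ m ≠ m₁, w ∈ m.asIdeal) :
    q.coeff ((δ + 1) * (maximalProd c).natDegree - 1) ≠ 0 := by
  classical
  obtain ⟨h, rfl⟩ := maximalProd_pow_dvd_of_aeval_dvd hc hspan hreg (hq ▸ dvd_mul_right _ _)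
  rw [map_mul, map_pow, mul_cancel_left_mem_nonZeroDivisors (pow_mem hreg δ)] at hq
  have heval (m : MaximalSpectrum B) : w ∈ m.asIdeal ↔ h.eval (c m) = 0 := by
    rw [← hq]
    exact aeval_mem_iff_eval_eq_zero m.isMaximal.ne_top (sub_algebraMap_mem hspan m) h
  have h0 : h ≠ 0 := by
    rintro rfl
    exact hw₁ ((heval m₁).mpr (by simp))
  have hdvd : ∏ m ∈ Finset.univ.erase m₁, (X - C (c m)) ∣ h := by
    refine Finset.prod_dvd_of_coprime (fun m _ n _ hmn => pairwise_coprime_X_sub_C hc hmn)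
      fun m hm => ?_
    rw [dvd_iff_isRoot, IsRoot, ← heval]
    exact hw m (Finset.ne_of_mem_erase hm)
  have hge := natDegree_le_of_dvd hdvd h0
  rw [natDegree_prod_of_monic _ _ fun m _ => monic_X_sub_C _] at hge
  simp only [natDegree_X_sub_C, Finset.sum_const, smul_eq_mul, mul_one,
    Finset.card_erase_of_mem (Finset.mem_univ m₁), Finset.card_univ] at hge
  rw [← natDegree_maximalProd c] at hge
  have hP := (monic_maximalProd c).pow δ
  have hne : maximalProd c ^ δ * h ≠ 0 := mul_ne_zero hP.ne_zero h0
  have hnat : (maximalProd c ^ δ * h).natDegree = δ * (maximalProd c).natDegree + h.natDegree := by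
    rw [hP.natDegree_mul' h0, (monic_maximalProd c).natDegree_pow]
  rw [degree_eq_natDegree hne, Nat.cast_lt, hnat, add_one_mul] at hdeg
  rw [show (δ + 1) * (maximalProd c).natDegree - 1 = (maximalProd c ^ δ * h).natDegree by
    rw [hnat, add_one_mul]; omega]
  exact leadingCoeff_ne_zero.mpr hne

end Leading

end MagicalElement
end

noncomputable section
namespace MagicalElement

open Polynomial Pointwise

/-- The assertion that the powers of `t` generate `B` over `k[[x]]`, together with the data needed
to compute orders at the maximal ideals of `B` in terms of `t`: here `F` is the characteristic
polynomial of `t`, and `δ` is the common ramification index. -/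
structure IsMonogenic (k : Type*) [Field k] {B : Type*} [CommRing B] [Algebra k⟦X⟧ B] [Algebra k B]
    (G : Type*) [Group G] [Fintype G] [MulSemiringAction G B] [Fintype (MaximalSpectrum B)]
    (t : B) (c : MaximalSpectrum B → k) (F : k⟦X⟧[X]) (δ : ℕ) : Prop where
  injective : Function.Injective c
  span_eq : ∀ m, m.asIdeal = Ideal.span {t - algebraMap k B (c m)}
  monic : F.Monic
  natDegree_eq : F.natDegree = Nat.card G
  map_eq_charpoly : F.map (algebraMap k⟦X⟧ B) = MulSemiringAction.charpoly G t
  map_constantCoeff_eq : F.map PowerSeries.constantCoeff = maximalProd c ^ δ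
  card_stabilizer_eq : ∀ m : MaximalSpectrum B, Nat.card (ramificationGroup G m.asIdeal 0) = δ
  exists_aeval_eq : ∀ b : B, ∃ q : k⟦X⟧[X], q.degree < Nat.card G ∧ aeval t q = b

/-! ### Existence of monogenic data, the different and the trace. -/

section Monogenic

set_option linter.unusedSectionVars false

variable {k : Type*} [Field k] {B : Type*} [CommRing B] [Algebra k⟦X⟧ B]
  [Algebra k B] [IsScalarTower k k⟦X⟧ B] [Module.Finite k⟦X⟧ B]
  {G : Type*} [Group G] [Fintype G] [MulSemiringAction G B] [SMulCommClass G k⟦X⟧ B]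
  [Algebra.IsInvariant k⟦X⟧ B G] [Fintype (MaximalSpectrum B)]

theorem aeval_eq_zero_of_map_eq_charpoly {t : B} {F : k⟦X⟧[X]}
    (hF : F.map (algebraMap k⟦X⟧ B) = MulSemiringAction.charpoly G t) : aeval t F = 0 := by
  rw [← eval_map_algebraMap, hF, MulSemiringAction.eval_charpoly]

variable (k G) in
theorem exists_isMonogenic [IsAlgClosed k] {L : Type*} [CommRing L] [Algebra B L]
    (hinj : Function.Injective (algebraMap B L))
    (hcl : ∀ z : L, IsIntegral B z → ∃ b : B, algebraMap B L b = z)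
    (hX : IsUnit (algebraMap B L (algebraMap k⟦X⟧ B PowerSeries.X)))
    (m₁ : MaximalSpectrum B) :
    ∃ (t : B) (c : MaximalSpectrum B → k) (F : k⟦X⟧[X]) (δ : ℕ), IsMonogenic k G t c F δ := by
  have hnt : Nontrivial B := nontrivial_of_ne 0 1 fun h =>
    m₁.isMaximal.ne_top ((Ideal.eq_top_iff_one _).mpr (h ▸ zero_mem _))
  have hnoeth : IsNoetherianRing B := IsNoetherianRing.of_finite k⟦X⟧ B
  have hreg : algebraMap k⟦X⟧ B PowerSeries.X ∈ nonZeroDivisors B := by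
    refine mem_nonZeroDivisors_of_injective hinj hX.mem_nonZeroDivisors
  have hk (m : MaximalSpectrum B) (b : B) : ∃ c : k, b - algebraMap k B c ∈ m.asIdeal :=
    have := m.isMaximal
    exists_sub_algebraMap_mem m.asIdeal b
  have hinf : Infinite k := IsAlgClosed.instInfinite
  obtain ⟨t, c, hc, hspan⟩ := exists_forall_eq_span_sub (k := k) hreg fun m => by
    have := m.isMaximal
    have hxm := algebraMap_X_mem k m.asIdeal
    obtain ⟨b, hb, hbm⟩ := exists_not_dvd_forall_dvd_mul hxm fun q _ hq =>
      isMaximal_of_algebraMap_X_mem k q hq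
    exact ⟨b, hbm, exists_mul_eq_mul_notMem hinj hcl hX hxm hb hbm⟩
  obtain ⟨F, hF, hdeg, hchar⟩ := exists_monic_map_eq_charpoly k (G := G) t
  have hmap (m : MaximalSpectrum B) := map_constantCoeff_eq_maximalProd_pow hspan hchar m
  have hF0 := aeval_eq_zero_of_map_eq_charpoly hchar
  refine ⟨t, c, F, _, hc, hspan, hF, hdeg, hchar, hmap m₁, fun m => ?_, fun b => ?_⟩
  · rw [ramificationGroup_zero_eq_stabilizer (hk m)]
    have : Nonempty (MaximalSpectrum B) := ⟨m⟩
    have hr : (maximalProd c).natDegree ≠ 0 := by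
      rw [natDegree_maximalProd]
      exact Fintype.card_ne_zero (α := MaximalSpectrum B)
    -- The same reduction of F is a power of P for m and for m₁; comparing degrees equates the
    -- stabilizer orders.
    have := congrArg natDegree ((hmap m).symm.trans (hmap m₁))
    rw [(monic_maximalProd c).natDegree_pow, (monic_maximalProd c).natDegree_pow] at this
    exact Nat.eq_of_mul_eq_mul_right (Nat.pos_of_ne_zero hr) this
  · rw [← hdeg]
    exact exists_degree_lt_aeval_eq hc hspan hk hF hF0 (hmap m₁) b

variable {t : B} {c : MaximalSpectrum B → k} {F : k⟦X⟧[X]} {δ : ℕ} (H : IsMonogenic k G t c F δ)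
  {L : Type*} [CommRing L] [Algebra k⸨X⸩ L] [Algebra k⟦X⟧ L] [IsScalarTower k⟦X⟧ k⸨X⸩ L]
  [Algebra B L] [IsScalarTower k⟦X⟧ B L]

include H

theorem IsMonogenic.pos (m : MaximalSpectrum B) : 0 < δ := by
  rw [← H.card_stabilizer_eq m]
  exact Nat.card_pos

theorem IsMonogenic.natDegree_mul : Nat.card G = δ * (maximalProd c).natDegree := by
  rw [← H.natDegree_eq, ← H.monic.natDegree_map PowerSeries.constantCoeff, H.map_constantCoeff_eq,
    (monic_maximalProd c).natDegree_pow]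

theorem IsMonogenic.exists_unit_mul_eq
    (hk : ∀ (m : MaximalSpectrum B) (b : B), ∃ c : k, b - algebraMap k B c ∈ m.asIdeal)
    (hreg : algebraMap k⟦X⟧ B PowerSeries.X ∈ nonZeroDivisors B)
    (pb : PowerBasis k⸨X⸩ L) (hdim : pb.dim = Nat.card G) (hgen : pb.gen = algebraMap B L t)
    (m : MaximalSpectrum B) :
    ∃ u : Bˣ, algebraMap k⟦X⟧ B PowerSeries.X = aeval t (maximalProd c) ^ δ * u :=
  exists_unit_mul_eq_algebraMap_X (G := G) H.injective H.span_eq hk hreg H.monic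
    (aeval_eq_zero_of_map_eq_charpoly H.map_eq_charpoly) H.map_constantCoeff_eq
    (fun q hq => eq_zero_of_aeval_eq_zero pb hgen (by rwa [hdim, ← H.natDegree_eq])) m

theorem IsMonogenic.idealOrd_pow_mul
    (hreg : algebraMap k⟦X⟧ B PowerSeries.X ∈ nonZeroDivisors B)
    (m : MaximalSpectrum B) (s : ℕ) (b : B) :
    idealOrd m.asIdeal (aeval t (maximalProd c) ^ s * b) = s + idealOrd m.asIdeal b := by
  rw [aeval_maximalProd]
  exact idealOrd_prod_pow_mul H.span_eq (sub_algebraMap_mem_nonZeroDivisors H.span_eq hreg) m s b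

theorem IsMonogenic.idealOrd_mul
    (hreg : algebraMap k⟦X⟧ B PowerSeries.X ∈ nonZeroDivisors B)
    (m : MaximalSpectrum B) (a b : B) :
    idealOrd m.asIdeal (a * b) = idealOrd m.asIdeal a + idealOrd m.asIdeal b :=
  have := m.isMaximal
  MagicalElement.idealOrd_mul (H.span_eq m)
    (sub_algebraMap_mem_nonZeroDivisors H.span_eq hreg m) a b

theorem IsMonogenic.isUnit_derivative [Algebra.FormallyUnramified k⸨X⸩ L]
    (pb : PowerBasis k⸨X⸩ L) (hdim : pb.dim = Nat.card G) (hgen : pb.gen = algebraMap B L t) :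
    IsUnit (algebraMap B L (aeval t (derivative F))) := by
  have := isUnit_aeval_derivative pb (minpoly_gen_eq pb hgen H.monic
    (H.natDegree_eq.trans hdim.symm) (aeval_eq_zero_of_map_eq_charpoly H.map_eq_charpoly))
  rwa [derivative_map, aeval_map_algebraMap, hgen, aeval_algebraMap_apply] at this

/-- The different of `B` is generated by the `(d' + δ - 1)`-st power of the radical. -/
theorem IsMonogenic.exists_derivative_eq
    (hreg : algebraMap k⟦X⟧ B PowerSeries.X ∈ nonZeroDivisors B)
    (hinj : Function.Injective (algebraMap B L))
    (hden : ∀ z : L, ∃ (N : ℕ) (b : B), algebraMap k⟦X⟧ L PowerSeries.X ^ N * z = algebraMap B L b)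
    (hunit : IsUnit (algebraMap B L (aeval t (derivative F))))
    {u : Bˣ} (hu : algebraMap k⟦X⟧ B PowerSeries.X = aeval t (maximalProd c) ^ δ * u)
    (m₁ : MaximalSpectrum B) :
    ∃ v : Bˣ, aeval t (derivative F)
      = aeval t (maximalProd c) ^ (dPrime G m₁.asIdeal + (δ - 1)) * v := by
  classical
  have hunit_ord (m : MaximalSpectrum B) (u : Bˣ) : idealOrd m.asIdeal (u : B) = 0 :=
    idealOrd_eq_zero_iff.mpr fun h => m.isMaximal.ne_top (Ideal.eq_top_of_isUnit_mem _ h u.isUnit)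
  have hord (m : MaximalSpectrum B) : idealOrd m.asIdeal (aeval t (derivative F))
      = ((dPrime G m₁.asIdeal + (δ - 1) : ℕ) : ℕ∞) := by
    have := m.isMaximal
    have := m₁.isMaximal
    obtain ⟨g, hg⟩ := exists_eq_smul k G m₁.asIdeal m.asIdeal
    have hd : dPrime G m.asIdeal = dPrime G m₁.asIdeal := by rw [hg, dPrime_smul]
    have hD := aeval_derivative_eq_prod H.map_eq_charpoly
    rw [hD, ← hd, ← H.card_stabilizer_eq m]
    refine idealOrd_prod_sub_smul (H.span_eq m)
      (sub_algebraMap_mem_nonZeroDivisors H.span_eq hreg m) (fun σ b => ?_) ?_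
    · obtain ⟨q, -, hq⟩ := H.exists_aeval_eq b
      exact sub_smul_dvd_smul_sub hq σ
    -- The order is finite because F'(t), being a unit of L, divides a power of x in B.
    · obtain ⟨y, hy⟩ := hunit
      obtain ⟨N, b, hb⟩ := hden ↑y⁻¹
      have hb' : aeval t (derivative F) * b = algebraMap k⟦X⟧ B PowerSeries.X ^ N := by
        refine hinj ?_
        rw [map_mul, ← hy, ← hb, map_pow, ← IsScalarTower.algebraMap_apply, mul_left_comm,
          Units.mul_inv, mul_one]
      have := congrArg (idealOrd m.asIdeal) hb'
      rw [H.idealOrd_mul hreg, hu, mul_pow, ← pow_mul, H.idealOrd_pow_mul hreg, ← Units.val_pow_eq_pow_val,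
        hunit_ord, add_zero] at this
      rw [← hD]
      exact ne_top_of_le_ne_top (ENat.natCast_ne_top _) (this ▸ le_self_add)
  obtain ⟨v, hv⟩ : aeval t (maximalProd c) ^ (dPrime G m₁.asIdeal + (δ - 1))
      ∣ aeval t (derivative F) := by
    rw [aeval_maximalProd]
    exact prod_pow_dvd_of_forall_mem H.span_eq fun m => coe_le_idealOrd_iff.mp (hord m).ge
  have hvu : IsUnit v := isUnit_of_forall_notMem fun m => by
    have := hord m
    rw [hv, H.idealOrd_pow_mul hreg] at this
    rw [← idealOrd_eq_zero_iff]
    exact (ENat.add_right_injective_of_ne_top (ENat.natCast_ne_top _)) (this.trans (add_zero _).symm)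
  exact ⟨hvu.unit, hv⟩

/-- If `z` has a pole of order exactly `d'` at one maximal ideal, and a pole of smaller order at
all other ones, then its trace is a unit. -/
theorem IsMonogenic.exists_trace_eq [MulSemiringAction G L] [SMulCommClass G k⸨X⸩ L]
    (hsmul : ∀ (σ : G) (b : B), algebraMap B L (σ • b) = σ • algebraMap B L b)
    (hreg : algebraMap k⟦X⟧ B PowerSeries.X ∈ nonZeroDivisors B)
    (pb : PowerBasis k⸨X⸩ L) (hdim : pb.dim = Nat.card G) (hgen : pb.gen = algebraMap B L t)
    (hunit : IsUnit (algebraMap B L (aeval t (derivative F))))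
    {u v : Bˣ} (hu : algebraMap k⟦X⟧ B PowerSeries.X = aeval t (maximalProd c) ^ δ * u) {d : ℕ}
    (hv : aeval t (derivative F) = aeval t (maximalProd c) ^ (d + (δ - 1)) * v)
    {z : L} {w : B} (hz : algebraMap B L (aeval t (maximalProd c) ^ d) * z = algebraMap B L w)
    {m₁ : MaximalSpectrum B} (hw₁ : w ∉ m₁.asIdeal) (hw : ∀ m ≠ m₁, w ∈ m.asIdeal) :
    ∃ a : k⟦X⟧ˣ, Algebra.trace k⸨X⸩ L z = algebraMap k⟦X⟧ k⸨X⸩ a := by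
  -- From here on δ is one less than the ramification index.
  obtain ⟨δ, rfl⟩ := Nat.exists_eq_succ_of_ne_zero (H.pos m₁).ne'
  rw [Nat.succ_eq_add_one] at *
  rw [Nat.add_sub_cancel] at hv
  have hregP := aeval_maximalProd_mem_nonZeroDivisors H.span_eq hreg
  -- The element expanded in powers of t is z F'(t).
  obtain ⟨g, hg, hgv⟩ := H.exists_aeval_eq (aeval t (maximalProd c) ^ δ * (v * w))
  have htr : Algebra.trace k⸨X⸩ L z = algebraMap k⟦X⟧ k⸨X⸩ (g.coeff (Nat.card G - 1)) := by
    rw [← coeff_map]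
    have hder : aeval pb.gen (derivative (F.map (algebraMap k⟦X⟧ k⸨X⸩)))
        = algebraMap B L (aeval t (derivative F)) := by
      rw [derivative_map, aeval_map_algebraMap, hgen, aeval_algebraMap_apply]
    refine trace_eq_coeff (G := G) pb hdim (F := F.map (algebraMap k⟦X⟧ k⸨X⸩)) ?_ ?_
      (degree_map_le.trans_lt hg) ?_
    · rw [Polynomial.map_map, ← IsScalarTower.algebraMap_eq, IsScalarTower.algebraMap_eq k⟦X⟧ B L,
        ← Polynomial.map_map, H.map_eq_charpoly, MulSemiringAction.charpoly_eq,
        MulSemiringAction.charpoly_eq, Polynomial.map_prod]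
      refine Finset.prod_congr rfl fun σ _ => ?_
      rw [Polynomial.map_sub, map_X, map_C, hsmul, hgen]
    · rwa [hder]
    · rw [hder, hv, aeval_map_algebraMap, hgen, aeval_algebraMap_apply, hgv, pow_add, map_mul,
        map_mul, map_mul, map_mul, ← hz]
      ring
  have hcoeff : PowerSeries.constantCoeff (g.coeff (Nat.card G - 1)) ≠ 0 := by
    -- Since x = P(t)^(δ+1) u, the reduction of g takes the value P(t)^δ (vw - P(t)ub) at t; this
    -- cofactor lies in the same maximal ideals as w.
    obtain ⟨b, hb⟩ := algebraMap_X_dvd_aeval_sub g t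
    rw [← coeff_map, H.natDegree_mul]
    have hmem (m : MaximalSpectrum B) :
        v * w - aeval t (maximalProd c) * (u * b) ∈ m.asIdeal ↔ w ∈ m.asIdeal := by
      have hP : aeval t (maximalProd c) ∈ m.asIdeal :=
        (aeval_maximalProd_dvd_iff H.span_eq).mp dvd_rfl m
      rw [Submodule.sub_mem_iff_left _ (Ideal.mul_mem_right _ _ hP), Ideal.unit_mul_mem_iff_mem _ v.isUnit]
    refine coeff_ne_zero_of_aeval_eq H.injective H.span_eq hregP
      (w := v * w - aeval t (maximalProd c) * (u * b)) (m₁ := m₁) ?_ ?_ ?_ fun m hm => ?_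
    · rw [← H.natDegree_mul]
      exact degree_map_le.trans_lt hg
    · rw [hgv, hu] at hb
      linear_combination -hb
    · rwa [hmem]
    · exact (hmem m).mpr (hw m hm)
  have : IsUnit (g.coeff (Nat.card G - 1)) :=
    PowerSeries.isUnit_iff_constantCoeff.mpr (isUnit_iff_ne_zero.mpr hcoeff)
  exact ⟨this.unit, htr⟩

end Monogenic

end MagicalElement
end

noncomputable section
namespace MagicalElement

open Polynomial

/-! ### The valuations of L in terms of P(t). -/

section Order

theorem map_add_neg_eq_map_add_neg {a b : ℕ∞} {d e : ℕ} (h : a + d = e + b) :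
    ENat.map (fun a : ℕ => (a : ℤ)) a + ((-(e : ℤ) : ℤ) : WithTop ℤ)
      = ENat.map (fun a : ℕ => (a : ℤ)) b + ((-(d : ℤ) : ℤ) : WithTop ℤ) := by
  cases a with
  | top =>
    cases b with
    | top => simp
    | coe b => simp [← Nat.cast_add] at h
  | coe a =>
    cases b with
    | top => simp [← Nat.cast_add] at h
    | coe b =>
      norm_cast at h
      rw [ENat.map_natCast, ENat.map_natCast, ← WithTop.coe_add, ← WithTop.coe_add]
      congr 1
      omega

theorem le_add_of_coe_neg_le {a : ℕ∞} {d e : ℕ} (h : ((-(d : ℤ) : ℤ) : WithTop ℤ) ≤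
    ENat.map (fun a : ℕ => (a : ℤ)) a + ((-(e : ℤ) : ℤ) : WithTop ℤ)) : (e : ℕ∞) ≤ d + a := by
  cases a with
  | top => simp
  | coe a =>
    rw [ENat.map_natCast, ← WithTop.coe_add, WithTop.coe_le_coe] at h
    norm_cast
    omega

theorem coe_neg_le_map_add (a : ℕ∞) (d : ℕ) : ((-(d : ℤ) : ℤ) : WithTop ℤ) ≤
    ENat.map (fun a : ℕ => (a : ℤ)) a + ((-(d : ℤ) : ℤ) : WithTop ℤ) := by
  cases a with
  | top => simp
  | coe a =>
    rw [ENat.map_natCast, ← WithTop.coe_add, WithTop.coe_le_coe]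
    omega

theorem map_add_eq_coe_neg_iff {a : ℕ∞} {d : ℕ} :
    ENat.map (fun a : ℕ => (a : ℤ)) a + ((-(d : ℤ) : ℤ) : WithTop ℤ)
      = ((-(d : ℤ) : ℤ) : WithTop ℤ) ↔ a = 0 := by
  cases a with
  | top =>
    rw [ENat.map_top, WithTop.top_add]
    exact iff_of_false WithTop.top_ne_coe ENat.top_ne_zero
  | coe a =>
    rw [ENat.map_natCast, ← WithTop.coe_add, WithTop.coe_inj, Nat.cast_eq_zero]
    omega

variable {k : Type*} [Field k] {L : Type*} [CommRing L] [Algebra k⸨X⸩ L]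
  [Algebra k⟦X⟧ L] [IsScalarTower k⟦X⟧ k⸨X⸩ L] [Algebra.Etale k⸨X⸩ L]

theorem exists_ord_eq (z : L) :
    ∃ (n : ℕ) (b : integralClosure k⟦X⟧ L), algebraMap k⟦X⟧ L PowerSeries.X ^ n * z = b ∧
      ∀ m : Ideal (integralClosure k⟦X⟧ L), ord m z =
        ENat.map (fun a : ℕ => (a : ℤ)) (idealOrd m b) + ((-((n * (idealOrd m (algebraMap k⟦X⟧
          (integralClosure k⟦X⟧ L) PowerSeries.X)).toNat : ℕ) : ℤ) : ℤ) : WithTop ℤ) := by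
  classical
  refine ⟨Nat.find (exists_X_pow_mul_mem (k := k) z),
    ⟨_, Nat.find_spec (exists_X_pow_mul_mem (k := k) z)⟩, rfl, fun m => ?_⟩
  rw [ord, Nat.cast_mul]

variable [Algebra k (integralClosure k⟦X⟧ L)]
  {G : Type*} [Group G] [Fintype G] [MulSemiringAction G L] [SMulCommClass G k⸨X⸩ L]
  [Fintype (MaximalSpectrum (integralClosure k⟦X⟧ L))]
  [IsScalarTower k k⟦X⟧ (integralClosure k⟦X⟧ L)]
  [Module.Finite k⟦X⟧ (integralClosure k⟦X⟧ L)]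
  [Algebra.IsInvariant k⟦X⟧ (integralClosure k⟦X⟧ L) G]
  {t : integralClosure k⟦X⟧ L} {c : MaximalSpectrum (integralClosure k⟦X⟧ L) → k} {F : k⟦X⟧[X]}
  {δ : ℕ} (H : IsMonogenic k G t c F δ)
  (hreg : algebraMap k⟦X⟧ (integralClosure k⟦X⟧ L) PowerSeries.X ∈ nonZeroDivisors _)
  {u : (integralClosure k⟦X⟧ L)ˣ}
  (hu : algebraMap k⟦X⟧ (integralClosure k⟦X⟧ L) PowerSeries.X = aeval t (maximalProd c) ^ δ * u)

set_option linter.unusedSectionVars false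

include H hreg hu

theorem IsMonogenic.idealOrd_X_pow_mul (m : MaximalSpectrum (integralClosure k⟦X⟧ L)) (n : ℕ)
    (b : integralClosure k⟦X⟧ L) :
    idealOrd m.asIdeal (algebraMap k⟦X⟧ (integralClosure k⟦X⟧ L) PowerSeries.X ^ n * b)
      = ((n * δ : ℕ) : ℕ∞) + idealOrd m.asIdeal b := by
  have hun : idealOrd m.asIdeal ((u ^ n : (integralClosure k⟦X⟧ L)ˣ) : integralClosure k⟦X⟧ L) = 0 :=
    idealOrd_eq_zero_iff.mpr fun h =>
      m.isMaximal.ne_top (Ideal.eq_top_of_isUnit_mem _ h (u ^ n).isUnit)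
  rw [hu, mul_pow, ← pow_mul, mul_assoc, H.idealOrd_pow_mul hreg, ← Units.val_pow_eq_pow_val,
    H.idealOrd_mul hreg, hun, zero_add, mul_comm]

theorem IsMonogenic.toNat_idealOrd_X (m : MaximalSpectrum (integralClosure k⟦X⟧ L)) :
    (idealOrd m.asIdeal (algebraMap k⟦X⟧ (integralClosure k⟦X⟧ L) PowerSeries.X)).toNat = δ := by
  have h1 : idealOrd m.asIdeal (1 : integralClosure k⟦X⟧ L) = 0 :=
    idealOrd_eq_zero_iff.mpr (Ideal.IsPrime.one_notMem m.isMaximal.isPrime)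
  have := H.idealOrd_X_pow_mul hreg hu m 1 1
  rw [pow_one, mul_one, h1, add_zero, one_mul] at this
  rw [this, ENat.toNat_natCast]

/-- `ord` may be computed with denominator P(t)^d: if x^n z = b, then x^n w = P(t)^d b, and orders
are additive. -/
theorem IsMonogenic.ord_eq {z : L} {d : ℕ} {w : integralClosure k⟦X⟧ L}
    (hz : (aeval t (maximalProd c) ^ d : integralClosure k⟦X⟧ L) * z = (w : L))
    (m : MaximalSpectrum (integralClosure k⟦X⟧ L)) :
    ord m.asIdeal z = ENat.map (fun a : ℕ => (a : ℤ)) (idealOrd m.asIdeal w)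
      + ((-(d : ℤ) : ℤ) : WithTop ℤ) := by
  obtain ⟨n, b, hb, hord⟩ := exists_ord_eq (k := k) z
  rw [hord, H.toNat_idealOrd_X hreg hu]
  refine map_add_neg_eq_map_add_neg ?_
  rw [← H.idealOrd_X_pow_mul hreg hu, add_comm, ← H.idealOrd_pow_mul hreg]
  congr 1
  refine Subtype.ext ?_
  rw [Subalgebra.coe_mul, ← hb, mul_left_comm, hz]
  rfl

/-- With x^n z = b, the element P(t)^d b has order at least nδ everywhere, so P(t)^(nδ) divides it,
and this is x^n up to a unit. -/
theorem IsMonogenic.exists_mul_eq_of_forall_le {z : L} {d : ℕ}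
    (hz : ∀ m : MaximalSpectrum (integralClosure k⟦X⟧ L),
      ((-(d : ℤ) : ℤ) : WithTop ℤ) ≤ ord m.asIdeal z) :
    ∃ w : integralClosure k⟦X⟧ L,
      (aeval t (maximalProd c) ^ d : integralClosure k⟦X⟧ L) * z = (w : L) := by
  obtain ⟨n, b, hb, hord⟩ := exists_ord_eq (k := k) z
  obtain ⟨w, hw⟩ : aeval t (maximalProd c) ^ (n * δ) ∣ aeval t (maximalProd c) ^ d * b := by
    rw [aeval_maximalProd]
    refine prod_pow_dvd_of_forall_mem H.span_eq fun m => coe_le_idealOrd_iff.mp ?_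
    rw [← aeval_maximalProd, H.idealOrd_pow_mul hreg]
    refine le_add_of_coe_neg_le ((hz m).trans_eq ?_)
    rw [hord, H.toNat_idealOrd_X hreg hu]
  refine ⟨(u⁻¹ ^ n : (integralClosure k⟦X⟧ L)ˣ) * w, ?_⟩
  have hX : algebraMap k⟦X⟧ (integralClosure k⟦X⟧ L) PowerSeries.X ^ n
      * ((u⁻¹ ^ n : (integralClosure k⟦X⟧ L)ˣ) * w) = aeval t (maximalProd c) ^ d * b := by
    rw [hw, hu, mul_pow, ← pow_mul, mul_comm δ n, ← Units.val_pow_eq_pow_val, inv_pow, mul_assoc,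
      Units.mul_inv_cancel_left]
  refine ((isUnit_algebraMap_X (k := k) (L := L)).pow n).mul_left_cancel ?_
  have := congrArg (Subtype.val) hX
  rw [Subalgebra.coe_mul, Subalgebra.coe_mul (S := integralClosure k⟦X⟧ L) (aeval t _ ^ d), ← hb] at this
  rw [mul_left_comm, ← this]
  rfl

end Order

end MagicalElement
end

/-! ### Both assertions. -/

noncomputable section
namespace MagicalElement

/-- `k` acts on the integral closure of `k[[x]]` through the constant power series. -/
@[reducible] def algebraConstants (k L : Type*) [Field k] [CommRing L] [Algebra k⟦X⟧ L] :
    Algebra k (integralClosure k⟦X⟧ L) :=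
  ((algebraMap k⟦X⟧ (integralClosure k⟦X⟧ L)).comp (algebraMap k k⟦X⟧)).toAlgebra

open Polynomial

/-- The trace criterion and the existence of magical elements, for an arbitrary finite group. -/
theorem isMagical_of_existsUnique_and_exists_isMagical {k : Type*} [Field k] [IsAlgClosed k]
    {G : Type*} [Group G] [Finite G]
    {L : Type*} [CommRing L] [Algebra k⸨X⸩ L] [Algebra k⟦X⟧ L] [IsScalarTower k⟦X⟧ k⸨X⸩ L]
    [MulSemiringAction G L] [SMulCommClass G k⸨X⸩ L]
    [Algebra.Etale k⸨X⸩ L] [Algebra.IsInvariant k⸨X⸩ L G]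
    (hrank : Module.finrank k⸨X⸩ L = Nat.card G)
    (m₁ : MaximalSpectrum (integralClosure k⟦X⟧ L)) :
    (∀ z : L,
      (∀ m : MaximalSpectrum (integralClosure k⟦X⟧ L),
        ((-(dPrime G m₁.asIdeal : ℤ) : ℤ) : WithTop ℤ) ≤ ord m.asIdeal z) →
      (∃! m : MaximalSpectrum (integralClosure k⟦X⟧ L),
        ord m.asIdeal z = ((-(dPrime G m₁.asIdeal : ℤ) : ℤ) : WithTop ℤ)) →
      IsMagical G m₁ z) ∧
    ∃ z : L, IsMagical G m₁ z := by
  classical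
  have := Fintype.ofFinite G
  have hnt : Nontrivial L :=
    Module.nontrivial_of_finrank_pos (R := k⸨X⸩) (hrank ▸ Nat.card_pos)
  let := algebraConstants k L
  have : IsScalarTower k k⟦X⟧ (integralClosure k⟦X⟧ L) := .of_algebraMap_eq fun _ => rfl
  have := finite_integralClosure k L
  have : Algebra.IsInvariant k⟦X⟧ (integralClosure k⟦X⟧ L) G := isInvariant_integralClosure
  have := finite_maximalSpectrum k (integralClosure k⟦X⟧ L) G
  have := Fintype.ofFinite (MaximalSpectrum (integralClosure k⟦X⟧ L))
  have hinj : Function.Injective (algebraMap (integralClosure k⟦X⟧ L) L) := Subtype.val_injective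
  have hcl (z : L) (hz : IsIntegral (integralClosure k⟦X⟧ L) z) :
      ∃ b : integralClosure k⟦X⟧ L, algebraMap (integralClosure k⟦X⟧ L) L b = z :=
    ⟨⟨z, isIntegral_trans z hz⟩, rfl⟩
  have hX : IsUnit (algebraMap (integralClosure k⟦X⟧ L) L
      (algebraMap k⟦X⟧ (integralClosure k⟦X⟧ L) PowerSeries.X)) := isUnit_algebraMap_X
  have hreg : algebraMap k⟦X⟧ (integralClosure k⟦X⟧ L) PowerSeries.X ∈ nonZeroDivisors _ :=
    mem_nonZeroDivisors_of_injective hinj hX.mem_nonZeroDivisors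
  have hk (m : MaximalSpectrum (integralClosure k⟦X⟧ L)) (b : integralClosure k⟦X⟧ L) :
      ∃ c : k, b - algebraMap k _ c ∈ m.asIdeal :=
    have := m.isMaximal
    exists_sub_algebraMap_mem m.asIdeal b
  obtain ⟨t, c, F, δ, H⟩ := exists_isMonogenic k G hinj hcl hX m₁
  have hden (z : L) := exists_smul_coe_mem_integralClosure (k := k) z
  obtain ⟨pb, hdim, hgen⟩ := exists_powerBasis hden H.exists_aeval_eq hrank
  obtain ⟨u, hu⟩ := H.exists_unit_mul_eq hk hreg pb hdim hgen m₁
  have hunit := H.isUnit_derivative pb hdim hgen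
  obtain ⟨v, hv⟩ := H.exists_derivative_eq hreg hinj hden hunit hu m₁
  have key (z : L)
      (hz : ∀ m : MaximalSpectrum (integralClosure k⟦X⟧ L),
        ((-(dPrime G m₁.asIdeal : ℤ) : ℤ) : WithTop ℤ) ≤ ord m.asIdeal z)
      (hz₁ : ∃! m : MaximalSpectrum (integralClosure k⟦X⟧ L),
        ord m.asIdeal z = ((-(dPrime G m₁.asIdeal : ℤ) : ℤ) : WithTop ℤ)) :
      IsMagical G m₁ z := by
    refine ⟨hz, ?_⟩
    obtain ⟨w, hw⟩ := H.exists_mul_eq_of_forall_le hreg hu hz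
    have hiff (m : MaximalSpectrum (integralClosure k⟦X⟧ L)) :
        ord m.asIdeal z = ((-(dPrime G m₁.asIdeal : ℤ) : ℤ) : WithTop ℤ) ↔ w ∉ m.asIdeal := by
      rw [H.ord_eq hreg hu hw, map_add_eq_coe_neg_iff, idealOrd_eq_zero_iff]
    obtain ⟨m₀, hm₀, huniq⟩ := hz₁
    refine H.exists_trace_eq (fun _ _ => rfl) hreg pb hdim hgen hunit hu hv hw
      ((hiff m₀).mp hm₀) fun m hm => ?_
    by_contra hwm
    exact hm (huniq m ((hiff m).mpr hwm))
  refine ⟨key, ?_⟩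
  -- P(t) divides x, a unit of L, so dividing by P(t)^d' is allowed in L.
  have hP : IsUnit ((aeval t (maximalProd c) ^ dPrime G m₁.asIdeal : integralClosure k⟦X⟧ L) : L) := by
    rw [SubmonoidClass.coe_pow]
    rw [hu, map_mul, map_pow] at hX
    exact ((isUnit_pow_iff (H.pos m₁).ne').mp (isUnit_of_mul_isUnit_left hX)).pow _
  obtain ⟨y, hy⟩ := hP
  -- This w lies in every maximal ideal except m₁, so w / P(t)^d' has order -d' at m₁ and larger
  -- order elsewhere.
  let w : integralClosure k⟦X⟧ L := ∏ m ∈ Finset.univ.erase m₁, (t - algebraMap k _ (c m))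
  have hw : (aeval t (maximalProd c) ^ dPrime G m₁.asIdeal : integralClosure k⟦X⟧ L)
      * ((↑y⁻¹ : L) * w) = (w : L) := by
    rw [← hy, Units.mul_inv_cancel_left]
  have hord := H.ord_eq hreg hu hw
  refine ⟨_, key (↑y⁻¹ * w) (fun m => ?_) ⟨m₁, ?_, fun m hm => ?_⟩⟩
  · rw [hord]
    exact coe_neg_le_map_add _ _
  · beta_reduce
    rw [hord, map_add_eq_coe_neg_iff, idealOrd_eq_zero_iff]
    exact prod_erase_notMem H.span_eq m₁
  · beta_reduce at hm
    rw [hord, map_add_eq_coe_neg_iff, idealOrd_eq_zero_iff] at hm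
    by_contra hne
    exact hm (Ideal.mem_of_dvd _ (Finset.dvd_prod_of_mem _
      (Finset.mem_erase.mpr ⟨hne, Finset.mem_univ m⟩)) (sub_algebraMap_mem H.span_eq m))

end MagicalElement

end

/-- `L` is an étale `G`-Galois algebra over `k((x))`: it is étale of rank `#G`, and `G` acts on it by
`k((x))`-algebra automorphisms with ring of invariants `k((x))`. -/
theorem mainTheorem8 {k : Type*} [Field k] [IsAlgClosed k] {p : ℕ} [Fact p.Prime] [CharP k p]
    {G : Type*} [Group G] [Finite G] (hG : IsPGroup p G)
    {L : Type*} [CommRing L] [Algebra k⸨X⸩ L] [Algebra k⟦X⟧ L] [IsScalarTower k⟦X⟧ k⸨X⸩ L]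
    [MulSemiringAction G L] [SMulCommClass G k⸨X⸩ L]
    [Algebra.Etale k⸨X⸩ L] [Algebra.IsInvariant k⸨X⸩ L G]
    (hrank : Module.finrank k⸨X⸩ L = Nat.card G)
    (m₁ : MaximalSpectrum (integralClosure k⟦X⟧ L))
    (hstar : (MagicalElement.ramificationGroup G m₁.asIdeal 0).Normal) :
    (∀ z : L,
      (∀ m : MaximalSpectrum (integralClosure k⟦X⟧ L),
        ((-(MagicalElement.dPrime G m₁.asIdeal : ℤ) : ℤ) : WithTop ℤ)
          ≤ MagicalElement.ord m.asIdeal z) →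
      (∃! m : MaximalSpectrum (integralClosure k⟦X⟧ L),
        MagicalElement.ord m.asIdeal z
          = ((-(MagicalElement.dPrime G m₁.asIdeal : ℤ) : ℤ) : WithTop ℤ)) →
      MagicalElement.IsMagical G m₁ z) ∧
    ∃ z : L, MagicalElement.IsMagical G m₁ z :=
  MagicalElement.isMagical_of_existsUnique_and_exists_isMagical hrank m₁
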